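/- Let $n\ge 0$ be an integer, let $[n]=\{1,\dots,n\}$, and let $T_n$ be the set of triples $(i,j,k)$ with $1\le i<j<k\le n$. A signature function is a map $\sigma\colon T_n\to\{-,+\}$; for a sign $\xi$, $\overline{\xi}$ is the opposite sign. For $a<b<c<d$ in $[n]$, the $4$-tuple $(a,b,c,d)$ is of the form $\xi_1\xi_2\xi_3\xi_4$ in $\sigma$ if $\sigma(a,b,c)=\xi_1$, $\sigma(a,b,d)=\xi_2$, $\sigma(a,c,d)=\xi_3$ and $\sigma(b,c,d)=\xi_4$. A drawing of a graph represents its vertices by distinct points of the plane and each edge by a simple continuous arc joining its endpoints, such that edges pass through no vertices other than their endpoints, any two edges have only finitely many points in common, no two edges touch at an interior point (so at each common interior point they properly cross; such a point is a crossing), and no three edges meet at a common interior point. The drawing is $x$-monotone if every vertical line meets every edge in at most one point and no two vertices have the same $x$-coordinate. It is semisimple if adjacent edges do not cross, and simple if it is semisimple and no two edges have more than one common crossing. A drawing of the complete graph $K_n$ that is $x$-monotone, with vertices $v_1,\dots,v_n$ labelled by increasing $x$-coordinate, realizes $\sigma$ if for all $i<j<k$ we have $\sigma(i,j,k)=-$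 when $v_j$ lies above the edge $v_iv_k$, and $\sigma(i,j,k)=+$ otherwise. **Theorem.** A signature function $\sigma\colon T_n\to\{-,+\}$ can be realized by a semisimple $x$-monotone drawing of $K_n$ if and only if every $4$-tuple $a<b<c<d$ in $[n]$ is of one of the forms $${+}{+}{+}{+},\ {-}{-}{-}{-},\ {+}{+}{-}{-},\ {-}{-}{+}{+},\ {-}{+}{+}{-},\ {+}{-}{-}{+},\ {-}{-}{-}{+},\ {+}{+}{+}{-},\ {+}{-}{-}{-},\ {-}{+}{+}{+}$$ in $\sigma$. It can be realized by a simple $x$-monotone drawing of $K_n$ if and only if, in addition, there is no $5$-tuple $a<b<c<d<e$ in $[n]$ with $$\sigma(a,b,e)=\sigma(a,d,e)=\sigma(b,c,d)=\overline{\sigma(a,c,e)}.$$ -/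

import Mathlib

/-- `γ` is a simple continuous arc in the plane with endpoints `p` and `q`. -/
def IsSimpleArc (p q : ℝ × ℝ) (γ : Set (ℝ × ℝ)) : Prop :=
  ∃ c : Path p q, Function.Injective c ∧ Set.range c = γ

/-- The curves `α` and `β` properly cross at `p`: some homeomorphism of an open neighbourhood
of `p` onto an open subset of the plane sends `p` to the origin and, inside that neighbourhood,
`α` to the first and `β` to the second coordinate axis. (Curves that touch at `p`, or that share
infinitely many points near `p`, do not properly cross at `p`.) -/
def ProperlyCrossAt (α β : Set (ℝ × ℝ)) (p : ℝ × ℝ) : Prop :=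
  ∃ φ : OpenPartialHomeomorph (ℝ × ℝ) (ℝ × ℝ), p ∈ φ.source ∧ φ p = (0, 0) ∧
    ∀ q ∈ φ.source, (q ∈ α ↔ (φ q).2 = 0) ∧ (q ∈ β ↔ (φ q).1 = 0)

/-- A drawing of the graph `G` in the plane. The interior of the arc `arc e` is `arc e` without
the images of the two endpoints of `e`. -/
structure Drawing {V : Type*} (G : SimpleGraph V) where
  /-- the point representing a vertex -/
  point : V → ℝ × ℝ
  /-- the arc representing an edge -/
  arc : G.edgeSet → Set (ℝ × ℝ)
  /-- distinct vertices are represented by distinct points -/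
  point_injective : Function.Injective point
  /-- every edge is represented by a simple arc joining the images of its endpoints -/
  isSimpleArc : ∀ (u v : V) (h : G.Adj u v),
    IsSimpleArc (point u) (point v) (arc ⟨s(u, v), h⟩)
  /-- edges pass through no vertices other than their endpoints -/
  mem_of_point_mem_arc : ∀ (e : G.edgeSet) (w : V), point w ∈ arc e → w ∈ e.1
  /-- two edges have only finitely many points in common -/
  finite_inter : ∀ e f : G.edgeSet, e ≠ f → (arc e ∩ arc f).Finite
  /-- no two edges touch: they properly cross at each common interior point -/
  not_touch : ∀ e f : G.edgeSet, e ≠ f → ∀ p ∈ arc e ∩ arc f,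
    (∀ v ∈ e.1, p ≠ point v) → (∀ v ∈ f.1, p ≠ point v) → ProperlyCrossAt (arc e) (arc f) p
  /-- no three edges meet at a common interior point -/
  not_three : ∀ e f g : G.edgeSet, e ≠ f → f ≠ g → e ≠ g →
    ∀ p, p ∈ arc e → p ∈ arc f → p ∈ arc g →
      ∃ v, (v ∈ e.1 ∨ v ∈ f.1 ∨ v ∈ g.1) ∧ p = point v

namespace Drawing

variable {V : Type*} {G : SimpleGraph V} (D : Drawing G)

/-- The interior points of an edge. -/
def interiorPoints (e : G.edgeSet) : Set (ℝ × ℝ) :=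
  {p | p ∈ D.arc e ∧ ∀ v ∈ e.1, p ≠ D.point v}

/-- The crossings of two edges: common interior points where they properly cross. -/
def crossings (e f : G.edgeSet) : Set (ℝ × ℝ) :=
  {p | p ∈ D.interiorPoints e ∧ p ∈ D.interiorPoints f ∧
    ProperlyCrossAt (D.arc e) (D.arc f) p}

/-- Adjacent edges (distinct edges with a common endpoint) do not cross. -/
def IsSemisimple : Prop :=
  ∀ e f : G.edgeSet, e ≠ f → (∃ v, v ∈ e.1 ∧ v ∈ f.1) → D.crossings e f = ∅

/-- Adjacent edges do not cross, and no two edges have more than one common crossing. -/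
def IsSimple : Prop :=
  D.IsSemisimple ∧ ∀ e f : G.edgeSet, e ≠ f → (D.crossings e f).Subsingleton

/-- Every vertical line meets every edge in at most one point, and no two vertices share the
same `x`-coordinate. -/
def IsXMonotone : Prop :=
  (∀ (e : G.edgeSet) (x : ℝ), {p | p ∈ D.arc e ∧ p.1 = x}.Subsingleton) ∧
    Function.Injective fun v => (D.point v).1

end Drawing

/-- Signature functions: a sign `1` (plus) or `-1` (minus) for each triple `i < j < k` in
`Fin n`. -/
abbrev Signature (n : ℕ) : Type :=
  ∀ i j k : Fin n, i < j → j < k → ℤˣ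

/-- The point `p` lies above the (`x`-monotone) curve `γ`. -/
def LiesAbove (p : ℝ × ℝ) (γ : Set (ℝ × ℝ)) : Prop :=
  ∃ q ∈ γ, q.1 = p.1 ∧ q.2 < p.2

/-- The drawing `D` of the complete graph, with vertices labelled by increasing `x`-coordinate,
induces the signature function `σ`: for `i < j < k`, the sign of `(i, j, k)` is minus if vertex
`j` lies above the edge `ik`, and plus otherwise. -/
def Induces {n : ℕ} (D : Drawing (⊤ : SimpleGraph (Fin n))) (σ : Signature n) : Prop :=
  (StrictMono fun i => (D.point i).1) ∧
    ∀ (i j k : Fin n) (hij : i < j) (hjk : j < k),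
      (LiesAbove (D.point j) (D.arc ⟨s(i, k), (hij.trans hjk).ne⟩) → σ i j k hij hjk = -1) ∧
      (¬ LiesAbove (D.point j) (D.arc ⟨s(i, k), (hij.trans hjk).ne⟩) → σ i j k hij hjk = 1)

/-- The form of the 4-tuple `a < b < c < d` in `σ`. -/
def Signature.form {n : ℕ} (σ : Signature n) (a b c d : Fin n)
    (hab : a < b) (hbc : b < c) (hcd : c < d) : ℤˣ × ℤˣ × ℤˣ × ℤˣ :=
  (σ a b c hab hbc, σ a b d hab (hbc.trans hcd), σ a c d (hab.trans hbc) hcd, σ b c d hbc hcd)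

/-- The ten allowed forms of 4-tuples. -/
def allowedForms : Set (ℤˣ × ℤˣ × ℤˣ × ℤˣ) :=
  {(1, 1, 1, 1), (-1, -1, -1, -1), (1, 1, -1, -1), (-1, -1, 1, 1), (-1, 1, 1, -1),
    (1, -1, -1, 1), (-1, -1, -1, 1), (1, 1, 1, -1), (1, -1, -1, -1), (-1, 1, 1, 1)}

/-- Every 4-tuple is of one of the ten allowed forms in `σ`. -/
def Signature.AllFormsAllowed {n : ℕ} (σ : Signature n) : Prop :=
  ∀ (a b c d : Fin n) (hab : a < b) (hbc : b < c) (hcd : c < d),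
    σ.form a b c d hab hbc hcd ∈ allowedForms

/-- Some 5-tuple `a < b < c < d < e` has
`σ(a,b,e) = σ(a,d,e) = σ(b,c,d) = -σ(a,c,e)`. -/
def Signature.HasForbidden5Tuple {n : ℕ} (σ : Signature n) : Prop :=
  ∃ (a b c d e : Fin n) (hab : a < b) (hbc : b < c) (hcd : c < d) (hde : d < e),
    σ a b e hab (hbc.trans (hcd.trans hde)) = σ a d e (hab.trans (hbc.trans hcd)) hde ∧
    σ a d e (hab.trans (hbc.trans hcd)) hde = σ b c d hbc hcd ∧
    σ b c d hbc hcd = -σ a c e (hab.trans hbc) (hcd.trans hde)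

/-! Necessity is the intermediate value theorem: an excluded 4-tuple forces two adjacent edges to
change their vertical order between two vertices, and a forbidden 5-tuple forces `ae` and `bd` to
cross on each side of `c`.

For sufficiency, the ten forms say exactly that the edges leaving each vertex to the right, and
those leaving it to the left, are transitively ordered by the signs (`mem_allowedForms_iff`). Put
the vertices over the integers and draw edges as polygonal paths, so that only the order of the
edges over each vertex matters. Away from endpoints, two edges are compared over `m` by the last
vertex up to `m` on whose sides they differ and, failing that, by the first vertex that separates
them. Base-three integers (`StarSigns.height`) encode this rule, so it is consistent.

Each order is thus witnessed by a vertex in the common range of the two edges (`exists_separator`).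
For adjacent edges transitivity makes all witnesses agree, so they never cross. For other pairs, two
crossings give witnesses with alternating orders; compared with the orders at the ends of the common
range, these contradict transitivity or produce a forbidden 5-tuple (`NoDoubleCrossing.height_sub`).

Triple points are avoided by exponentiating the heights over odd vertices: this keeps every order
and makes three segments in one strip non-concurrent (`not_concurrent`). -/

/-! ### Leading digits in base three -/

/-- A balanced ternary-style sum is dominated by its highest nonzero digit. -/
theorem abs_sum_digit_le (d : ℕ → ℤ) (hd : ∀ t, |d t| ≤ 2) (N : ℕ) :
    |∑ t ∈ Finset.range N, d t * 3 ^ t| ≤ 3 ^ N - 1 := by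
  induction N with
  | zero => simp
  | succ N ih =>
    rw [Finset.sum_range_succ, pow_succ]
    have h1 := hd N
    have h3 : (0 : ℤ) < 3 ^ N := by positivity
    rw [abs_le] at *
    constructor <;> nlinarith

theorem exists_top_digit (d : ℕ → ℤ) (hd : ∀ t, |d t| ≤ 2) (N : ℕ) (h : ∃ t < N, d t ≠ 0) :
    ∃ t < N, d t ≠ 0 ∧ (∀ u, t < u → u < N → d u = 0) ∧
      0 < d t * ∑ u ∈ Finset.range N, d u * 3 ^ u := by
  induction N with
  | zero => obtain ⟨t, ht, _⟩ := h; omega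
  | succ N ih =>
    by_cases h0 : d N = 0
    · obtain ⟨t, ht, h1⟩ := h
      have htN : t ≠ N := by rintro rfl; exact h1 h0
      obtain ⟨u, hu, hu0, hu1, hu2⟩ := ih ⟨t, by omega, h1⟩
      refine ⟨u, by omega, hu0, fun v hv hvN => ?_, ?_⟩
      · rcases (show v < N ∨ v = N by omega) with h | rfl
        · exact hu1 v hv h
        · exact h0
      · rw [Finset.sum_range_succ, h0]
        simpa using hu2
    · refine ⟨N, by omega, h0, fun v hv hvN => by omega, ?_⟩
      have hb := abs_sum_digit_le d hd N
      rw [Finset.sum_range_succ]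
      generalize ∑ t ∈ Finset.range N, d t * 3 ^ t = A at *
      have h3 : (0 : ℤ) < 3 ^ N := by positivity
      generalize (3 : ℤ) ^ N = B at *
      rw [abs_le] at hb
      rcases lt_or_gt_of_ne h0 with h | h
      · exact mul_pos_of_neg_of_neg h (by nlinarith)
      · exact mul_pos h (by nlinarith)

theorem mul_pos_of_mul_pos_right {x y z : ℤ} (h : 0 < x * y) (h' : 0 < z * y) : 0 < z * x := by
  have h1 := mul_pos h h'
  rw [show x * y * (z * y) = z * x * y ^ 2 by ring] at h1
  exact pos_of_mul_pos_left h1 (sq_nonneg y)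

/-! ### Ordered stars and integer heights of edges -/

/-- Sign functions on triples of natural numbers in which all left stars and all right stars are
linearly ordered. -/
structure StarSigns where
  /-- the sign of a triple -/
  sign : ℕ → ℕ → ℕ → ℤ
  sign_eq : ∀ i j k, sign i j k = 1 ∨ sign i j k = -1
  right_trans : ∀ i j k l, i < j → j < k → k < l → sign i j k = sign i k l →
    sign i j l = sign i k l
  left_trans : ∀ i j k l, i < j → j < k → k < l → sign i j l = sign j k l →
    sign i k l = sign i j l

namespace StarSigns

variable (S : StarSigns)

/-- No edge nested inside another one is separated from it in the pattern that forces two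
crossings. -/
def NoDoubleCrossing : Prop :=
  ∀ a b c d e, a < b → b < c → c < d → d < e →
    ¬ (S.sign a b e = S.sign a d e ∧ S.sign a d e = S.sign b c d ∧
      S.sign b c d = -S.sign a c e)

/-- The position of the edge `(i, k)` relative to the vertex `j`. -/
def side (i k j : ℕ) : ℤ := if i < j ∧ j < k then S.sign i j k else 0

theorem side_of_lt {i k j : ℕ} (h : i < j) (h' : j < k) : S.side i k j = S.sign i j k := by
  simp [side, h, h']

theorem side_left (i k : ℕ) : S.side i k i = 0 := by simp [side]

theorem side_right (i k : ℕ) : S.side i k k = 0 := by simp [side]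

theorem side_of_le {i k j : ℕ} (h : j ≤ i) : S.side i k j = 0 := by
  simp [side, show ¬ i < j by omega]

theorem side_cases (i k j : ℕ) : S.side i k j = 0 ∨ S.side i k j = 1 ∨ S.side i k j = -1 := by
  unfold side
  split_ifs
  · exact Or.inr (S.sign_eq _ _ _)
  · exact Or.inl rfl

/-- The digits of the height of the edge `(i, k)`. -/
def digit (n i k t : ℕ) : ℤ := if t ≤ n then S.side i k (n - t) else S.side i k (t - n - 1)

theorem digit_cases (n i k t : ℕ) :
    S.digit n i k t = 0 ∨ S.digit n i k t = 1 ∨ S.digit n i k t = -1 := by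
  unfold digit
  split_ifs <;> exact S.side_cases _ _ _

/-- The height of the edge `(i, k)` over the vertex `m`: edges are ordered by the last vertex up
to `m` that separates them, and edges which no such vertex separates by the first one that
does. -/
def height (n i k m : ℕ) : ℤ :=
  -- The value 0 is the common height of all vertices before rescaling, so edges meet at their
  -- shared endpoints.
  if m = i ∨ m = k then 0 else ∑ t ∈ Finset.range (n + m + 2), S.digit n i k t * 3 ^ t

theorem height_left (n i k : ℕ) : S.height n i k i = 0 := by simp [height]

theorem height_right (n i k : ℕ) : S.height n i k k = 0 := by simp [height]

/-- This range is what the base of the exponential heights has to exceed by a factor of two. -/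
theorem abs_height_lt (n i k m : ℕ) (hm : m ≤ n) : |S.height n i k m| < 3 ^ (2 * n + 2) := by
  unfold height
  split_ifs
  · simp
  · have h := abs_sum_digit_le (S.digit n i k)
      (fun t => by rcases S.digit_cases n i k t with h | h | h <;> simp [h]) (n + m + 2)
    have h2 : (3 : ℤ) ^ (n + m + 2) ≤ 3 ^ (2 * n + 2) :=
      pow_le_pow_right₀ (by norm_num) (by omega)
    linarith

/-- The vertex `m` itself supplies the leading digit over `m`, so an edge passes `m` on the
prescribed side of height 0. -/
theorem sign_mul_height_pos {n i k m : ℕ} (hi : i < m) (hk : m < k) :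
    0 < S.sign i m k * S.height n i k m := by
  -- Position `n + m + 1` belongs to `m`. Descending positions run through `m - 1, …, 0` and then,
  -- from position `n` on, through `0, …, n`.
  have hd : S.digit n i k (n + m + 1) = S.sign i m k := by
    unfold digit
    rw [if_neg (by omega), show n + m + 1 - n - 1 = m by omega, S.side_of_lt hi hk]
  have h0 : S.sign i m k ≠ 0 := by rcases S.sign_eq i m k with h | h <;> simp [h]
  obtain ⟨t, ht, ht0, htop, hpos⟩ := exists_top_digit (S.digit n i k)
    (fun t => by rcases S.digit_cases n i k t with h | h | h <;> simp [h]) (n + m + 2)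
    ⟨n + m + 1, by omega, by rwa [hd]⟩
  have : t = n + m + 1 := by
    by_contra hne
    exact h0 (hd ▸ htop (n + m + 1) (by omega) (by omega))
  subst this
  rw [hd] at hpos
  rwa [height, if_neg (by omega)]

/-- The vertex deciding the order of two edges over the vertex `m`. -/
theorem exists_separator {n i k i' k' m : ℕ} (hkn : k < n) (hkn' : k' < n)
    (hne : i ≠ i' ∨ k ≠ k') (hi : i ≤ m) (hi' : i' ≤ m) (hk : m ≤ k) (hk' : m ≤ k')
    (hm : ¬ ((m = i ∨ m = k) ∧ (m = i' ∨ m = k'))) :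
    ∃ j, 0 < (S.side i k j - S.side i' k' j) * (S.height n i k m - S.height n i' k' m) ∧
      i ≤ j ∧ i' ≤ j ∧ j ≤ k ∧ j ≤ k' ∧
      ((j ≤ m ∧ ∀ j', j < j' → j' ≤ m → S.side i k j' = S.side i' k' j') ∨ i = i') := by
  by_cases h1 : m = i ∨ m = k
  · have h2 : ¬ (m = i' ∨ m = k') := fun h => hm ⟨h1, h⟩
    refine ⟨m, ?_, hi, hi', hk, hk', Or.inl ⟨le_rfl, fun j' _ _ => by omega⟩⟩
    have := S.sign_mul_height_pos (n := n) (show i' < m by omega) (show m < k' by omega)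
    rw [show S.side i k m = 0 by rcases h1 with rfl | rfl <;> simp [side],
      show S.height n i k m = 0 by simp [height, h1], S.side_of_lt (by omega) (by omega)]
    linarith
  by_cases h2 : m = i' ∨ m = k'
  · refine ⟨m, ?_, hi, hi', hk, hk', Or.inl ⟨le_rfl, fun j' _ _ => by omega⟩⟩
    have := S.sign_mul_height_pos (n := n) (show i < m by omega) (show m < k by omega)
    rw [show S.side i' k' m = 0 by rcases h2 with rfl | rfl <;> simp [side],
      show S.height n i' k' m = 0 by simp [height, h2], S.side_of_lt (by omega) (by omega)]
    linarith
  have hnz : ∀ a b c, S.sign a b c ≠ 0 := fun a b c => by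
    rcases S.sign_eq a b c with h | h <;> simp [h]
  -- Digits differ by at most 2, so in base 3 the leading difference decides the comparison.
  have hdig : ∀ t, |S.digit n i k t - S.digit n i' k' t| ≤ 2 := fun t => by
    rcases S.digit_cases n i k t with h | h | h <;>
    rcases S.digit_cases n i' k' t with h' | h' | h' <;> simp [h, h']
  have hlow : ∀ j, j ≤ n → S.digit n i k (n - j) - S.digit n i' k' (n - j) =
      S.side i k j - S.side i' k' j := fun j hj => by
    unfold digit
    rw [if_pos (by omega), if_pos (by omega), show n - (n - j) = j by omega]
  have hhigh : ∀ j, S.digit n i k (n + j + 1) - S.digit n i' k' (n + j + 1) =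
      S.side i k j - S.side i' k' j := fun j => by
    unfold digit
    rw [if_neg (by omega), if_neg (by omega), show n + j + 1 - n - 1 = j by omega]
  -- Where the later edge starts, the other one passes strictly above or below it; `hright` is the
  -- mirror image.
  have hleft : i ≠ i' → S.side i k (max i i') - S.side i' k' (max i i') ≠ 0 := by
    intro h
    rcases lt_or_gt_of_ne h with h | h
    · rw [max_eq_right h.le, S.side_left, S.side_of_lt h (by omega), sub_zero]; exact hnz _ _ _
    · rw [max_eq_left h.le, S.side_left, S.side_of_lt h (by omega), zero_sub, neg_ne_zero]
      exact hnz _ _ _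
  have hright : k ≠ k' → S.side i k (min k k') - S.side i' k' (min k k') ≠ 0 := by
    intro h
    rcases lt_or_gt_of_ne h with h | h
    · rw [min_eq_left h.le, S.side_right, S.side_of_lt (by omega) h, zero_sub, neg_ne_zero]
      exact hnz _ _ _
    · rw [min_eq_right h.le, S.side_right, S.side_of_lt (by omega) h, sub_zero]; exact hnz _ _ _
  obtain ⟨t, ht, ht0, htop, hpos⟩ := exists_top_digit
    (fun t => S.digit n i k t - S.digit n i' k' t) hdig (n + m + 2) (by
      by_cases h : i = i'
      · exact ⟨n - min k k', by omega, by
          rw [hlow _ (by omega)]; exact hright (by tauto)⟩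
      · exact ⟨n + max i i' + 1, by omega, by rw [hhigh]; exact hleft h⟩)
  have hsum : S.height n i k m - S.height n i' k' m =
      ∑ u ∈ Finset.range (n + m + 2), (S.digit n i k u - S.digit n i' k' u) * 3 ^ u := by
    rw [height, if_neg h1, height, if_neg h2, ← Finset.sum_sub_distrib]
    exact Finset.sum_congr rfl fun u _ => by ring
  rw [← hsum] at hpos
  -- A leading position up to `n` means that no vertex up to `m` separates the edges. Different left
  -- ends would be separated at `max i i'`, so the left ends agree.
  by_cases htn : t ≤ n
  · have heq : i = i' := by
      by_contra h
      have := htop (n + max i i' + 1) (by omega) (by omega)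
      rw [hhigh] at this
      exact hleft h this
    obtain ⟨j, rfl, hjn⟩ : ∃ j, t = n - j ∧ j ≤ n := ⟨n - t, by omega, by omega⟩
    rw [hlow j hjn] at hpos ht0
    refine ⟨j, hpos, ?_, ?_, ?_, ?_, Or.inr heq⟩
    · by_contra h
      rw [S.side_of_le (show j ≤ i by omega), S.side_of_le (show j ≤ i' by omega)] at ht0
      exact ht0 rfl
    · by_contra h
      rw [S.side_of_le (show j ≤ i by omega), S.side_of_le (show j ≤ i' by omega)] at ht0
      exact ht0 rfl
    all_goals
      by_contra h
      have := htop (n - min k k') (by omega) (by omega)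
      rw [hlow _ (by omega)] at this
      exact hright (by tauto) this
  · obtain ⟨j, rfl⟩ : ∃ j, t = n + j + 1 := ⟨t - n - 1, by omega⟩
    rw [hhigh] at hpos ht0
    have hmax : max i i' ≤ j := by
      by_contra h
      by_cases heq : i = i'
      · rw [S.side_of_le (show j ≤ i by omega), S.side_of_le (show j ≤ i' by omega)] at ht0
        exact ht0 rfl
      · have := htop (n + max i i' + 1) (by omega) (by omega)
        rw [hhigh] at this
        exact hleft heq this
    refine ⟨j, hpos, by omega, by omega, by omega, by omega, Or.inl ⟨by omega, fun j' h h' => ?_⟩⟩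
    have := htop (n + j' + 1) (by omega) (by omega)
    rw [hhigh] at this
    linarith

theorem height_ne {n i k i' k' m : ℕ} (hkn : k < n) (hkn' : k' < n)
    (hne : i ≠ i' ∨ k ≠ k') (hi : i ≤ m) (hi' : i' ≤ m) (hk : m ≤ k) (hk' : m ≤ k')
    (hm : ¬ ((m = i ∨ m = k) ∧ (m = i' ∨ m = k'))) :
    S.height n i k m ≠ S.height n i' k' m := by
  obtain ⟨j, hj, -⟩ := S.exists_separator hkn hkn' hne hi hi' hk hk' hm
  intro h
  rw [h, sub_self, mul_zero] at hj
  exact lt_irrefl _ hj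

/-- Two edges with the same left endpoint are separated in the same order everywhere. -/
theorem side_sub_of_left_eq {i k l j : ℕ} (hkl : k < l) (hi : i < j) (hk : j ≤ k) :
    0 ≤ S.sign i k l * (S.side i l j - S.side i k j) := by
  rcases hk.eq_or_lt with rfl | hk
  · rw [S.side_right, S.side_of_lt hi hkl]
    rcases S.sign_eq i j l with h | h <;> simp [h]
  · rw [S.side_of_lt hi hk, S.side_of_lt hi (hk.trans hkl)]
    have := S.right_trans i j k l hi hk hkl
    rcases S.sign_eq i j l with h | h <;> rcases S.sign_eq i j k with h' | h' <;>
      rcases S.sign_eq i k l with h'' | h'' <;> simp_all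

/-- Two edges with the same right endpoint are separated in the same order everywhere. -/
theorem side_sub_of_right_eq {i i' k j : ℕ} (hii : i < i') (hi : i' ≤ j) (hk : j < k) :
    0 ≤ S.sign i i' k * (S.side i k j - S.side i' k j) := by
  rcases hi.eq_or_lt with rfl | hi
  · rw [S.side_left, S.side_of_lt hii hk]
    rcases S.sign_eq i i' k with h | h <;> simp [h]
  · rw [S.side_of_lt hi hk, S.side_of_lt (hii.trans hi) hk]
    have := S.left_trans i i' j k hii hi hk
    rcases S.sign_eq i i' k with h | h <;> rcases S.sign_eq i' j k with h' | h' <;>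
      rcases S.sign_eq i j k with h'' | h'' <;> simp_all

/-- Adjacent edges keep their order. -/
theorem height_sub_of_adjacent {n i k i' k' : ℕ} (hkn : k < n) (hkn' : k' < n)
    (hne : i ≠ i' ∨ k ≠ k') (hadj : i = i' ∨ k = k') :
    ∃ s : ℤ, ∀ m, i ≤ m → i' ≤ m → m ≤ k → m ≤ k' →
      S.height n i k m ≠ S.height n i' k' m →
      0 < s * (S.height n i k m - S.height n i' k' m) := by
  -- The sign `s` is read off at the endpoint that lies inside the longer of the two edges.
  have main : ∃ s : ℤ, ∀ j, i ≤ j → i' ≤ j → j ≤ k → j ≤ k' →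
      0 ≤ s * (S.side i k j - S.side i' k' j) ∧ (s = 1 ∨ s = -1) := by
    have hpm := S.sign_eq
    rcases hadj with rfl | rfl
    · rcases lt_or_gt_of_ne (show k ≠ k' by tauto) with h | h
      · refine ⟨-S.sign i k k', fun j h1 _ h3 _ => ⟨?_, ?_⟩⟩
        · rcases h1.eq_or_lt with rfl | h1
          · simp [side_left]
          · linarith [S.side_sub_of_left_eq h h1 h3]
        · rcases hpm i k k' with h | h <;> simp [h]
      · refine ⟨S.sign i k' k, fun j h1 _ _ h3 => ⟨?_, hpm _ _ _⟩⟩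
        rcases h1.eq_or_lt with rfl | h1
        · simp [side_left]
        · exact S.side_sub_of_left_eq h h1 h3
    · rcases lt_or_gt_of_ne (show i ≠ i' by tauto) with h | h
      · refine ⟨S.sign i i' k, fun j _ h1 h3 _ => ⟨?_, hpm _ _ _⟩⟩
        rcases h3.eq_or_lt with rfl | h3
        · simp [side_right]
        · exact S.side_sub_of_right_eq h h1 h3
      · refine ⟨-S.sign i' i k, fun j h1 _ h3 _ => ⟨?_, ?_⟩⟩
        · rcases h3.eq_or_lt with rfl | h3
          · simp [side_right]
          · linarith [S.side_sub_of_right_eq h h1 h3]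
        · rcases hpm i' i k with h | h <;> simp [h]
  obtain ⟨s, hs⟩ := main
  refine ⟨s, fun m h1 h2 h3 h4 hm => ?_⟩
  have hm' : ¬ ((m = i ∨ m = k) ∧ (m = i' ∨ m = k')) := fun h => hm (by simp [height, h.1, h.2])
  obtain ⟨j, hj, hj1, hj2, hj3, hj4, -⟩ := S.exists_separator hkn hkn' hne h1 h2 h3 h4 hm'
  obtain ⟨hs1, hs2⟩ := hs j hj1 hj2 hj3 hj4
  rcases hs2 with rfl | rfl
  · nlinarith
  · nlinarith

/-! ### Two edges change their order at most once -/

/-- For the interleaved edges `ac` and `bd`, the edge `bc` can pass `m₁` on neither side: on side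
`-s` the right star of `b` drags `bd` along, on side `s` the left star of `c` drags `ac` along. -/
theorem crossing_pair_aux {a b c d m₁ : ℕ} {s : ℤ} (hab : a < b) (hb : b < m₁) (hc : m₁ < c)
    (hcd : c < d) (h1 : S.sign a b c = s) (h2 : S.sign a m₁ c = -s) (h3 : S.sign b m₁ d = s)
    (h4 : S.sign b c d = -s) : False := by
  have e1 := S.right_trans b m₁ c d hb hc hcd
  have e2 := S.left_trans a b m₁ c hab hb hc
  rcases S.sign_eq b m₁ c with h | h <;> rcases S.sign_eq a b c with h' | h' <;> grind

variable {S}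

/-- Two edges that are separated in the same order over both ends of their common range are not
separated in the opposite order in between. -/
theorem NoDoubleCrossing.not_reversed (hS : S.NoDoubleCrossing) {i k i' k' m : ℕ} {s : ℤ}
    (hs : s = 1 ∨ s = -1) (hi : i ≠ i') (hk : k ≠ k')
    (h1 : i < m) (h2 : i' < m) (h3 : m < k) (h4 : m < k')
    (hl : 0 < s * (S.side i k (max i i') - S.side i' k' (max i i')))
    (hm : s * (S.side i k m - S.side i' k' m) < 0)
    (hr : 0 < s * (S.side i k (min k k') - S.side i' k' (min k k'))) : False := by
  rw [S.side_of_lt h1 h3, S.side_of_lt h2 h4] at hm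
  have hpm := S.sign_eq
  wlog h : i < i' generalizing i k i' k' s
  · refine this (s := -s) (by rcases hs with rfl | rfl <;> simp) hi.symm hk.symm h2 h1 h4 h3
      (by rw [max_comm]; linarith) (by linarith) (by rw [min_comm]; linarith) (by omega)
  rw [max_eq_right h.le, S.side_left, S.side_of_lt h (by omega)] at hl
  -- Interleaved edges contradict transitivity alone; nested edges form the forbidden 5-tuple `i,
  -- i', m, k', k`.
  rcases lt_or_gt_of_ne hk with h' | h'
  · rw [min_eq_left h'.le, S.side_right, S.side_of_lt (by omega) h'] at hr
    have e0 := hpm i i' k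
    have e1 := hpm i m k
    have e2 := hpm i' m k'
    have e3 := hpm i' k k'
    refine S.crossing_pair_aux (s := s) h h2 h3 h' ?_ ?_ ?_ ?_ <;>
      rcases hs with rfl | rfl <;> omega
  · rw [min_eq_right h'.le, S.side_right, S.side_of_lt (by omega) h'] at hr
    have e0 := hpm i i' k
    have e1 := hpm i m k
    have e2 := hpm i' m k'
    have e3 := hpm i k' k
    refine hS i i' m k' k h h2 h4 h' ?_
    rcases hs with rfl | rfl <;> refine ⟨?_, ?_, ?_⟩ <;> omega

/-- Two edges that are separated in different orders over the ends of their common range change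
their order only once in between. -/
theorem NoDoubleCrossing.not_alternating (hS : S.NoDoubleCrossing) {i k i' k' m₁ m₂ : ℕ} {s : ℤ}
    (hs : s = 1 ∨ s = -1) (hi : i ≠ i') (hk : k ≠ k')
    (h1 : i < m₁) (h2 : i' < m₁) (hm : m₁ < m₂) (h3 : m₂ < k) (h4 : m₂ < k')
    (hm₁ : s * (S.side i k m₁ - S.side i' k' m₁) < 0)
    (hm₂ : 0 < s * (S.side i k m₂ - S.side i' k' m₂))
    (hr : s * (S.side i k (min k k') - S.side i' k' (min k k')) < 0) : False := by
  rw [S.side_of_lt h1 (by omega), S.side_of_lt h2 (by omega)] at hm₁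
  rw [S.side_of_lt (by omega) h3, S.side_of_lt (by omega) h4] at hm₂
  have hpm := S.sign_eq
  wlog h : k < k' generalizing i k i' k' s
  · refine this (s := -s) (by rcases hs with rfl | rfl <;> simp) hi.symm hk.symm h2 h1 h4 h3
      (by linarith) (by linarith) (by rw [min_comm]; linarith) (by omega)
  rw [min_eq_left h.le, S.side_right, S.side_of_lt (by omega) h] at hr
  have e1 := hpm i m₁ k
  have e2 := hpm i' m₁ k'
  have e3 := hpm i m₂ k
  have e4 := hpm i' m₂ k'
  have e5 := hpm i' k k'
  have e6 := hpm m₁ m₂ k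
  -- The left star of `k` puts `m₁k` on side `s` of `m₂`. Replacing `ik` by `m₁k` gives an edge
  -- nested in `i'k'`, whence a forbidden 5-tuple.
  have e7 := S.left_trans i m₁ m₂ k h1 hm h3
  refine hS i' m₁ m₂ k k' h2 hm h3 h ?_
  rcases hs with rfl | rfl <;> refine ⟨?_, ?_, ?_⟩ <;> omega

/-- The order of two edges changes at most once. -/
theorem NoDoubleCrossing.height_sub (hS : S.NoDoubleCrossing) {n i k i' k' p q r : ℕ} {s : ℤ}
    (hs : s = 1 ∨ s = -1) (hkn : k < n) (hkn' : k' < n) (hi : i ≠ i') (hk : k ≠ k')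
    (hip : i ≤ p) (hip' : i' ≤ p) (hpq : p < q) (hqr : q < r) (hrk : r ≤ k) (hrk' : r ≤ k')
    (hp : 0 < s * (S.height n i k p - S.height n i' k' p))
    (hq : s * (S.height n i k q - S.height n i' k' q) < 0)
    (hr : 0 < s * (S.height n i k r - S.height n i' k' r)) : False := by
  have sep : ∀ m, i ≤ m → i' ≤ m → m ≤ k → m ≤ k' →
      S.height n i k m - S.height n i' k' m ≠ 0 →
      ∃ j, 0 < (S.side i k j - S.side i' k' j) * (S.height n i k m - S.height n i' k' m) ∧
      i ≤ j ∧ i' ≤ j ∧ j ≤ m ∧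
        ∀ j', j < j' → j' ≤ m → S.side i k j' = S.side i' k' j' := by
    intro m h1 h2 h3 h4 h5
    obtain ⟨j, hj, hj1, hj2, -, -, hj5 | hj5⟩ := S.exists_separator hkn hkn' (Or.inl hi) h1 h2 h3 h4
      (fun h => h5 (by simp [height, h.1, h.2]))
    · exact ⟨j, hj, hj1, hj2, hj5⟩
    · exact absurd hj5 hi
  obtain ⟨p', p1, p2, p3, p4, p5⟩ := sep p hip hip' (by omega) (by omega)
    (fun h => by simp [h] at hp)
  obtain ⟨q', q1, q2, q3, q4, q5⟩ := sep q (by omega) (by omega) (by omega) (by omega)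
    (fun h => by simp [h] at hq)
  obtain ⟨r', r1, r2, r3, r4, r5⟩ := sep r (by omega) (by omega) (by omega) (by omega)
    (fun h => by simp [h] at hr)
  have hpd : 0 < s * (S.side i k p' - S.side i' k' p') :=
    mul_pos_of_mul_pos_right p1 hp
  have hqd : s * (S.side i k q' - S.side i' k' q') < 0 := by
    have := mul_pos_of_mul_pos_right q1 (show 0 < -s * _ by rw [neg_mul]; exact neg_pos.2 hq)
    rwa [neg_mul, neg_pos] at this
  have hrd : 0 < s * (S.side i k r' - S.side i' k' r') :=
    mul_pos_of_mul_pos_right r1 hr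
  -- If `q' ≤ p`, then `p'` and `q'` are both the last separating vertex up to `p`, so they
  -- coincide, yet they carry opposite orders. Hence `p' ≤ p < q' ≤ q < r' ≤ r`.
  have hpq' : p < q' := by
    by_contra h
    rcases lt_trichotomy p' q' with h' | rfl | h'
    · simp [p5 q' h' (by omega)] at hqd
    · linarith
    · simp [q5 p' h' (by omega)] at hpd
  have hqr' : q < r' := by
    by_contra h
    rcases lt_trichotomy q' r' with h' | rfl | h'
    · simp [q5 r' h' (by omega)] at hrd
    · linarith
    · simp [r5 q' h' (by omega)] at hqd
  have hl : S.side i k (max i i') - S.side i' k' (max i i') ≠ 0 := by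
    rcases lt_or_gt_of_ne hi with h | h
    · rw [max_eq_right h.le, S.side_left, S.side_of_lt h (by omega)]
      rcases S.sign_eq i i' k with h | h <;> simp [h]
    · rw [max_eq_left h.le, S.side_left, S.side_of_lt h (by omega)]
      rcases S.sign_eq i' i k' with h | h <;> simp [h]
  have hre : S.side i k (min k k') - S.side i' k' (min k k') ≠ 0 := by
    rcases lt_or_gt_of_ne hk with h | h
    · rw [min_eq_left h.le, S.side_right, S.side_of_lt (by omega) h]
      rcases S.sign_eq i' k k' with h | h <;> simp [h]
    · rw [min_eq_right h.le, S.side_right, S.side_of_lt (by omega) h]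
      rcases S.sign_eq i k' k with h | h <;> simp [h]
  have hs0 : s ≠ 0 := by rcases hs with rfl | rfl <;> simp
  have hs' : -s = 1 ∨ -s = -1 := by rcases hs with rfl | rfl <;> simp
  -- Equal orders at the two ends of the common range are reversed at `p'` or `q'`; unequal ones
  -- leave an alternation on `p', q'` or on `q', r'`.
  rcases lt_or_gt_of_ne (mul_ne_zero hs0 hl) with hl | hl
  · have hp'l : p' ≠ max i i' := by intro h; rw [← h] at hl; exact lt_asymm hl hpd
    rcases lt_or_gt_of_ne (mul_ne_zero hs0 hre) with hre | hre
    · exact hS.not_reversed (m := p') hs' hi hk (by omega) (by omega) (by omega) (by omega)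
        (by rw [neg_mul]; exact neg_pos.2 hl) (by rw [neg_mul]; exact neg_neg_of_pos hpd)
        (by rw [neg_mul]; exact neg_pos.2 hre)
    · exact hS.not_alternating (m₁ := p') (m₂ := q') hs' hi hk (by omega) (by omega) (by omega)
        (by omega) (by omega) (by rw [neg_mul]; exact neg_neg_of_pos hpd)
        (by rw [neg_mul]; exact neg_pos.2 hqd) (by rw [neg_mul]; exact neg_neg_of_pos hre)
  · rcases lt_or_gt_of_ne (mul_ne_zero hs0 hre) with hre | hre
    · have hr'r : r' ≠ min k k' := by intro h; rw [← h] at hre; exact lt_asymm hre hrd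
      exact hS.not_alternating (m₁ := q') (m₂ := r') hs hi hk (by omega) (by omega) (by omega)
        (by omega) (by omega) hqd hrd hre
    · exact hS.not_reversed (m := q') hs hi hk (by omega) (by omega) (by omega) (by omega)
        hl hqd hre

end StarSigns

/-! ### Graphs as arcs, affine crossings, polygonal functions -/

/-- The graph of a continuous function over a compact interval is a simple arc. -/
theorem isSimpleArc_graph {f : ℝ → ℝ} (hf : Continuous f) {a b : ℝ} (hab : a ≠ b) :
    IsSimpleArc (a, f a) (b, f b) {p | min a b ≤ p.1 ∧ p.1 ≤ max a b ∧ p.2 = f p.1} := by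
  have hab' : b - a ≠ 0 := sub_ne_zero.2 hab.symm
  refine ⟨{ toFun := fun t => (a + t * (b - a), f (a + t * (b - a)))
            continuous_toFun := by fun_prop
            source' := by simp
            target' := by simp }, ?_, ?_⟩
  · intro s t h
    have h1 : a + s * (b - a) = a + t * (b - a) := congrArg Prod.fst h
    exact Subtype.ext (mul_right_cancel₀ hab' (add_left_cancel h1))
  · ext p
    constructor
    · rintro ⟨t, rfl⟩
      have h0 := t.2.1
      have h1 := t.2.2
      change min a b ≤ a + t * (b - a) ∧ a + t * (b - a) ≤ max a b ∧ _ = _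
      refine ⟨?_, ?_, rfl⟩ <;> rcases le_total a b with h | h
      · rw [min_eq_left h]; nlinarith
      · rw [min_eq_right h]; nlinarith
      · rw [max_eq_right h]; nlinarith
      · rw [max_eq_left h]; nlinarith
    · rintro ⟨h1, h2, h3⟩
      have hx : a + (p.1 - a) / (b - a) * (b - a) = p.1 := by field_simp; ring
      refine ⟨⟨(p.1 - a) / (b - a), ?_⟩, ?_⟩
      · rcases lt_or_gt_of_ne hab with h | h
        · rw [min_eq_left h.le] at h1
          rw [max_eq_right h.le] at h2
          exact ⟨div_nonneg (by linarith) (by linarith), (div_le_one (by linarith)).2 (by linarith)⟩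
        · rw [min_eq_right h.le] at h1
          rw [max_eq_left h.le] at h2
          exact ⟨div_nonneg_of_nonpos (by linarith) (by linarith),
            (div_le_one_of_neg (by linarith)).2 (by linarith)⟩
      · change (a + (p.1 - a) / (b - a) * (b - a), f (a + (p.1 - a) / (b - a) * (b - a))) = p
        rw [hx, ← h3]

/-- Curves that are lines of different slopes in a vertical strip properly cross at their common
point in the strip. -/
theorem properlyCrossAt_of_affine {α β : Set (ℝ × ℝ)} {a₀ a₁ b₀ b₁ l r : ℝ} (hab : a₁ ≠ b₁)
    (hα : ∀ q : ℝ × ℝ, l < q.1 → q.1 < r → (q ∈ α ↔ q.2 = a₀ + a₁ * q.1))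
    (hβ : ∀ q : ℝ × ℝ, l < q.1 → q.1 < r → (q ∈ β ↔ q.2 = b₀ + b₁ * q.1))
    {p : ℝ × ℝ} (hl : l < p.1) (hr : p.1 < r) (hpα : p ∈ α) (hpβ : p ∈ β) :
    ProperlyCrossAt α β p := by
  have hd : a₁ - b₁ ≠ 0 := sub_ne_zero.2 hab
  -- The coordinates are the vertical offsets from the two lines; they are independent because the
  -- slopes differ.
  let φ : ℝ × ℝ ≃ₜ ℝ × ℝ :=
    { toFun := fun q => (q.2 - (b₀ + b₁ * q.1), q.2 - (a₀ + a₁ * q.1))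
      invFun := fun w => ((w.1 - w.2 - (a₀ - b₀)) * (a₁ - b₁)⁻¹,
        w.2 + (a₀ + a₁ * ((w.1 - w.2 - (a₀ - b₀)) * (a₁ - b₁)⁻¹)))
      left_inv := fun q => by
        have h : (q.2 - (b₀ + b₁ * q.1) - (q.2 - (a₀ + a₁ * q.1)) - (a₀ - b₀)) * (a₁ - b₁)⁻¹ =
            q.1 := by
          rw [show q.2 - (b₀ + b₁ * q.1) - (q.2 - (a₀ + a₁ * q.1)) - (a₀ - b₀) =
            q.1 * (a₁ - b₁) by ring, mul_assoc, mul_inv_cancel₀ hd, mul_one]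
        ext
        · exact h
        · simp only [h]; ring
      right_inv := fun w => by
        have h : (w.1 - w.2 - (a₀ - b₀)) * (a₁ - b₁)⁻¹ * (a₁ - b₁) = w.1 - w.2 - (a₀ - b₀) := by
          rw [mul_assoc, inv_mul_cancel₀ hd, mul_one]
        ext
        · simp only
          linear_combination h
        · simp only
          ring
      continuous_toFun := by fun_prop
      continuous_invFun := by fun_prop }
  have hopen : IsOpen {q : ℝ × ℝ | l < q.1 ∧ q.1 < r} :=
    (isOpen_lt continuous_const continuous_fst).inter (isOpen_lt continuous_fst continuous_const)
  have hsrc : ∀ q, q ∈ (φ.toOpenPartialHomeomorph.restrOpen _ hopen).source ↔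
      l < q.1 ∧ q.1 < r := fun q => by
    simp
  have hφ : ∀ q, φ.toOpenPartialHomeomorph.restrOpen _ hopen q =
      (q.2 - (b₀ + b₁ * q.1), q.2 - (a₀ + a₁ * q.1)) := fun q => rfl
  refine ⟨φ.toOpenPartialHomeomorph.restrOpen _ hopen, (hsrc p).2 ⟨hl, hr⟩, ?_, fun q hq => ?_⟩
  · rw [hφ, (hα p hl hr).1 hpα]
    have := (hα p hl hr).1 hpα ▸ (hβ p hl hr).1 hpβ
    rw [this]
    simp
  · rw [hφ, hα q ((hsrc q).1 hq).1 ((hsrc q).1 hq).2, hβ q ((hsrc q).1 hq).1 ((hsrc q).1 hq).2]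
    exact ⟨sub_eq_zero.symm, sub_eq_zero.symm⟩

/-- The piecewise linear function on `[0, n]` with value `u m` at each integer `m`. -/
noncomputable def polyline (u : ℕ → ℝ) (n : ℕ) (x : ℝ) : ℝ :=
  u 0 + ∑ j ∈ Finset.range n, (u (j + 1) - u j) * max 0 (min 1 (x - j))

theorem continuous_polyline (u : ℕ → ℝ) (n : ℕ) : Continuous (polyline u n) := by
  unfold polyline
  fun_prop

theorem polyline_add (u : ℕ → ℝ) {n m : ℕ} (hm : m < n) {t : ℝ} (h0 : 0 ≤ t) (h1 : t ≤ 1) :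
    polyline u n (m + t) = (1 - t) * u m + t * u (m + 1) := by
  induction n with
  | zero => omega
  | succ n ih =>
    have hstep : polyline u (n + 1) (m + t) = polyline u n (m + t) +
        (u (n + 1) - u n) * max 0 (min 1 (m + t - n)) := by
      simp only [polyline, Finset.sum_range_succ, add_assoc]
    rw [hstep]
    -- Left of `n` the new summand is clamped to 0; in the last strip the earlier summands are
    -- saturated and telescope.
    rcases (show m < n ∨ m = n by omega) with h | rfl
    · have hmn : (m : ℝ) + 1 ≤ n := by exact_mod_cast h
      rw [ih h, max_eq_left (le_trans (min_le_right _ _) (by linarith))]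
      ring
    · have hfull : polyline u m (m + t) = u m := by
        have : ∀ j ∈ Finset.range m,
            (u (j + 1) - u j) * max 0 (min 1 ((m : ℝ) + t - j)) = u (j + 1) - u j := by
          intro j hj
          have hjm : (j : ℝ) + 1 ≤ m := by exact_mod_cast Finset.mem_range.1 hj
          rw [min_eq_left (by linarith), max_eq_right zero_le_one, mul_one]
        rw [polyline, Finset.sum_congr rfl this, Finset.sum_range_sub]
        ring
      rw [hfull, add_sub_cancel_left, min_eq_right h1, max_eq_right h0]
      ring

theorem polyline_natCast (u : ℕ → ℝ) {n m : ℕ} (hm : m < n) : polyline u n m = u m := by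
  simpa using polyline_add u hm le_rfl zero_le_one

/-! ### Polygonal drawings from edge heights -/

/-- Heights of the edges of the complete graph over the vertices `0, …, n - 1`, from which a
drawing by polygonal paths can be read off. -/
structure EdgeHeights (n : ℕ) where
  /-- the height of the edge `(i, k)` over `m` -/
  height : ℕ → ℕ → ℕ → ℝ
  /-- the height of a vertex -/
  vertex : ℕ → ℝ
  left : ∀ i k, i < k → k < n → height i k i = vertex i
  right : ∀ i k, i < k → k < n → height i k k = vertex k
  avoid : ∀ i m k, i < m → m < k → k < n → height i k m ≠ vertex m
  distinct : ∀ i k i' k' m, k < n → k' < n → (i ≠ i' ∨ k ≠ k') → i ≤ m → i' ≤ m → m ≤ k →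
    m ≤ k' → height i k m = height i' k' m → (m = i ∨ m = k) ∧ (m = i' ∨ m = k')
  general : ∀ i₁ k₁ i₂ k₂ i₃ k₃ m, k₁ < n → k₂ < n → k₃ < n → (i₁ ≠ i₂ ∨ k₁ ≠ k₂) →
    (i₂ ≠ i₃ ∨ k₂ ≠ k₃) → (i₁ ≠ i₃ ∨ k₁ ≠ k₃) → i₁ ≤ m → i₂ ≤ m → i₃ ≤ m →
    m < k₁ → m < k₂ → m < k₃ → ∀ t : ℝ, 0 < t → t < 1 →
    (1 - t) * height i₁ k₁ m + t * height i₁ k₁ (m + 1) =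
      (1 - t) * height i₂ k₂ m + t * height i₂ k₂ (m + 1) →
    (1 - t) * height i₂ k₂ m + t * height i₂ k₂ (m + 1) =
      (1 - t) * height i₃ k₃ m + t * height i₃ k₃ (m + 1) → False

/-- The smaller endpoint of an edge. -/
def edgeLo {n : ℕ} (e : (⊤ : SimpleGraph (Fin n)).edgeSet) : ℕ := e.1.inf

/-- The larger endpoint of an edge. -/
def edgeHi {n : ℕ} (e : (⊤ : SimpleGraph (Fin n)).edgeSet) : ℕ := e.1.sup

section Edges

variable {n : ℕ} (e f : (⊤ : SimpleGraph (Fin n)).edgeSet)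

theorem edgeLo_lt_edgeHi : edgeLo e < edgeHi e := by
  obtain ⟨e, he⟩ := e
  induction e with
  | h u v =>
    have : u ≠ v := by simpa using he
    simpa [edgeLo, edgeHi] using this.symm

theorem edgeHi_lt : edgeHi e < n := e.1.sup.2

theorem mem_edge_iff (v : Fin n) : v ∈ e.1 ↔ (v : ℕ) = edgeLo e ∨ (v : ℕ) = edgeHi e := by
  obtain ⟨e, he⟩ := e
  induction e with
  | h u w =>
    simp only [edgeLo, edgeHi, Sym2.inf_mk, Sym2.sup_mk, Sym2.mem_iff, Fin.val_inj]
    rcases le_total u w with h | h <;> simp [h, or_comm]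

variable {e f}

theorem edge_ne (h : e ≠ f) : edgeLo e ≠ edgeLo f ∨ edgeHi e ≠ edgeHi f := by
  by_contra hc
  push Not at hc
  exact h (Subtype.ext (Sym2.inf_eq_inf_and_sup_eq_sup.1
    ⟨Fin.val_injective hc.1, Fin.val_injective hc.2⟩))

end Edges

namespace EdgeHeights

variable {n : ℕ} (Y : EdgeHeights n)

/-- The function whose graph is the edge `(i, k)`. -/
noncomputable def curve (i k : ℕ) : ℝ → ℝ := polyline (Y.height i k) n

/-- The arc representing an edge. -/
def arc (e : (⊤ : SimpleGraph (Fin n)).edgeSet) : Set (ℝ × ℝ) :=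
  {p | (edgeLo e : ℝ) ≤ p.1 ∧ p.1 ≤ edgeHi e ∧ p.2 = Y.curve (edgeLo e) (edgeHi e) p.1}

/-- The point representing a vertex. -/
def point (v : Fin n) : ℝ × ℝ := ((v : ℕ), Y.vertex v)

/-- The edges `e` and `f` cross over the open interval between `m` and `m + 1`. -/
def CrossAfter (e f : (⊤ : SimpleGraph (Fin n)).edgeSet) (m : ℕ) : Prop :=
  edgeLo e ≤ m ∧ edgeLo f ≤ m ∧ m < edgeHi e ∧ m < edgeHi f ∧
    (Y.height (edgeLo e) (edgeHi e) m - Y.height (edgeLo f) (edgeHi f) m) *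
      (Y.height (edgeLo e) (edgeHi e) (m + 1) - Y.height (edgeLo f) (edgeHi f) (m + 1)) < 0

theorem exists_nat_or_strip {e : (⊤ : SimpleGraph (Fin n)).edgeSet} {p : ℝ × ℝ}
    (hp : p ∈ Y.arc e) :
    (∃ m : ℕ, p.1 = m ∧ edgeLo e ≤ m ∧ m ≤ edgeHi e ∧
      p.2 = Y.height (edgeLo e) (edgeHi e) m) ∨
    ∃ (m : ℕ) (t : ℝ), p.1 = m + t ∧ 0 < t ∧ t < 1 := by
  obtain ⟨h1, h2, h3⟩ := hp
  have h0 : 0 ≤ p.1 := le_trans (Nat.cast_nonneg _) h1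
  have hf := Nat.floor_le h0
  have hf' := Nat.lt_floor_add_one p.1
  rcases hf.eq_or_lt with h | h
  · left
    rw [← h] at h1 h2 h3
    have h2' : ⌊p.1⌋₊ ≤ edgeHi e := by exact_mod_cast h2
    refine ⟨⌊p.1⌋₊, h.symm, by exact_mod_cast h1, h2', ?_⟩
    rw [h3, curve, polyline_natCast _ (h2'.trans_lt (edgeHi_lt e))]
  · exact Or.inr ⟨⌊p.1⌋₊, p.1 - ⌊p.1⌋₊, by ring, by linarith, by linarith⟩

theorem arc_strip {e : (⊤ : SimpleGraph (Fin n)).edgeSet} {p : ℝ × ℝ} {m : ℕ} {t : ℝ}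
    (hx : p.1 = m + t) (h0 : 0 < t) (h1 : t < 1) :
    p ∈ Y.arc e ↔ edgeLo e ≤ m ∧ m < edgeHi e ∧
      p.2 = (1 - t) * Y.height (edgeLo e) (edgeHi e) m +
        t * Y.height (edgeLo e) (edgeHi e) (m + 1) := by
  have hlo : (edgeLo e : ℝ) ≤ p.1 ↔ edgeLo e ≤ m := by
    rw [hx]
    constructor
    · intro h
      have : (edgeLo e : ℝ) < (m + 1 : ℕ) := by push_cast; linarith
      exact Nat.lt_succ_iff.1 (Nat.cast_lt.1 this)
    · intro h
      have : (edgeLo e : ℝ) ≤ m := Nat.cast_le.2 h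
      linarith
  have hhi : p.1 ≤ edgeHi e ↔ m < edgeHi e := by
    rw [hx]
    constructor
    · intro h
      have : (m : ℝ) < edgeHi e := by linarith
      exact Nat.cast_lt.1 this
    · intro h
      have : ((m + 1 : ℕ) : ℝ) ≤ edgeHi e := Nat.cast_le.2 h
      push_cast at this
      linarith
  change _ ∧ _ ∧ _ ↔ _
  rw [hlo, hhi]
  refine and_congr_right fun _ => and_congr_right fun h => ?_
  rw [hx, curve, polyline_add _ (h.trans (edgeHi_lt e)) h0.le h1.le]

/-- At a common point inside the strip, the height differences at its two sides are opposite in sign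
or both zero. Both zero would make `m` and `m + 1` the endpoints of both edges, which are distinct.
-/
theorem crossAfter_of_strip {e f : (⊤ : SimpleGraph (Fin n)).edgeSet} (hef : e ≠ f) {p : ℝ × ℝ}
    {m : ℕ} {t : ℝ} (hx : p.1 = m + t) (h0 : 0 < t) (h1 : t < 1) (hpe : p ∈ Y.arc e)
    (hpf : p ∈ Y.arc f) : Y.CrossAfter e f m := by
  obtain ⟨e1, e2, e3⟩ := (Y.arc_strip hx h0 h1).1 hpe
  obtain ⟨f1, f2, f3⟩ := (Y.arc_strip hx h0 h1).1 hpf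
  refine ⟨e1, f1, e2, f2, ?_⟩
  have hne := edge_ne hef
  have d1 := Y.distinct _ _ _ _ m (edgeHi_lt e) (edgeHi_lt f) hne e1 f1 e2.le f2.le
  have d2 := Y.distinct _ _ _ _ (m + 1) (edgeHi_lt e) (edgeHi_lt f) hne (by omega) (by omega)
    e2 f2
  rw [e3] at f3
  generalize Y.height (edgeLo e) (edgeHi e) m = a at *
  generalize Y.height (edgeLo e) (edgeHi e) (m + 1) = a' at *
  generalize Y.height (edgeLo f) (edgeHi f) m = b at *
  generalize Y.height (edgeLo f) (edgeHi f) (m + 1) = b' at *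
  have hab : a ≠ b := by
    rintro rfl
    have hab' : a' = b' := by
      have : t * (a' - b') = 0 := by linarith
      rcases mul_eq_zero.1 this with h | h
      · linarith
      · linarith
    have := d1 rfl
    have := d2 hab'
    omega
  have key : (1 - t) * (a - b) = -t * (a' - b') := by linarith
  have hpos : 0 < (1 - t) * (a - b) ^ 2 := by
    have := sub_ne_zero.2 hab
    have : 0 < 1 - t := by linarith
    positivity
  have : t * ((a - b) * (a' - b')) < 0 := by
    have h : t * ((a - b) * (a' - b')) = -((1 - t) * (a - b) ^ 2) := by
      linear_combination (a - b) * key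
    linarith
  exact (pos_iff_neg_of_mul_neg this).1 h0

/-- Two edges meet at a common endpoint or between two consecutive vertices. -/
theorem inter_arc {e f : (⊤ : SimpleGraph (Fin n)).edgeSet} (hef : e ≠ f) {p : ℝ × ℝ}
    (hpe : p ∈ Y.arc e) (hpf : p ∈ Y.arc f) :
    (∃ v : Fin n, v ∈ e.1 ∧ v ∈ f.1 ∧ p = Y.point v) ∨
      ∃ (m : ℕ) (t : ℝ), p.1 = m + t ∧ 0 < t ∧ t < 1 ∧ Y.CrossAfter e f m := by
  rcases Y.exists_nat_or_strip hpe with ⟨m, hm, e1, e2, e3⟩ | ⟨m, t, hx, h0, h1⟩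
  · left
    obtain ⟨f1, f2, f3⟩ := hpf
    rw [hm] at f1 f2 f3
    rw [Nat.cast_le] at f1 f2
    rw [curve, polyline_natCast _ (f2.trans_lt (edgeHi_lt f))] at f3
    obtain ⟨he, hf⟩ := Y.distinct _ _ _ _ m (edgeHi_lt e) (edgeHi_lt f) (edge_ne hef) e1 f1 e2 f2
      (e3.symm.trans f3)
    refine ⟨⟨m, e2.trans_lt (edgeHi_lt e)⟩, (mem_edge_iff _ _).2 he, (mem_edge_iff _ _).2 hf,
      Prod.ext hm ?_⟩
    change p.2 = Y.vertex m
    rw [e3]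
    rcases he with he | he
    · rw [he, Y.left _ _ (edgeLo_lt_edgeHi e) (edgeHi_lt e)]
    · rw [he, Y.right _ _ (edgeLo_lt_edgeHi e) (edgeHi_lt e)]
  · exact Or.inr ⟨m, t, hx, h0, h1, Y.crossAfter_of_strip hef hx h0 h1 hpe hpf⟩

/-- On the strip the difference of the two edges is affine and changes sign, so it vanishes only
once. -/
theorem eq_of_crossAfter {e f : (⊤ : SimpleGraph (Fin n)).edgeSet} {p q : ℝ × ℝ} {m : ℕ}
    (h : Y.CrossAfter e f m) {s t : ℝ} (hp : p.1 = m + s) (hs0 : 0 < s) (hs1 : s < 1)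
    (hq : q.1 = m + t) (ht0 : 0 < t) (ht1 : t < 1)
    (hpe : p ∈ Y.arc e) (hpf : p ∈ Y.arc f) (hqe : q ∈ Y.arc e) (hqf : q ∈ Y.arc f) : p = q := by
  obtain ⟨-, -, p1⟩ := (Y.arc_strip hp hs0 hs1).1 hpe
  obtain ⟨-, -, p2⟩ := (Y.arc_strip hp hs0 hs1).1 hpf
  obtain ⟨-, -, q1⟩ := (Y.arc_strip hq ht0 ht1).1 hqe
  obtain ⟨-, -, q2⟩ := (Y.arc_strip hq ht0 ht1).1 hqf
  obtain ⟨-, -, -, -, h⟩ := h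
  have hst : s = t := by
    by_contra hne
    rw [p1] at p2
    rw [q1] at q2
    generalize Y.height (edgeLo e) (edgeHi e) m = a at *
    generalize Y.height (edgeLo e) (edgeHi e) (m + 1) = a' at *
    generalize Y.height (edgeLo f) (edgeHi f) m = b at *
    generalize Y.height (edgeLo f) (edgeHi f) (m + 1) = b' at *
    have h1 : (s - t) * ((a' - b') - (a - b)) = 0 := by linear_combination p2 - q2
    rcases mul_eq_zero.1 h1 with h1 | h1
    · exact hne (by linarith)
    · have : a' - b' = a - b := by linarith
      rw [this] at h
      nlinarith [mul_self_nonneg (a - b)]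
  subst hst
  exact Prod.ext (hp.trans hq.symm) (p1.trans q1.symm)

theorem properlyCrossAt_of_crossAfter {e f : (⊤ : SimpleGraph (Fin n)).edgeSet} {p : ℝ × ℝ}
    {m : ℕ} (h : Y.CrossAfter e f m) {t : ℝ} (hx : p.1 = m + t) (h0 : 0 < t) (h1 : t < 1)
    (hpe : p ∈ Y.arc e) (hpf : p ∈ Y.arc f) : ProperlyCrossAt (Y.arc e) (Y.arc f) p := by
  have line : ∀ g : (⊤ : SimpleGraph (Fin n)).edgeSet, edgeLo g ≤ m → m < edgeHi g →
      ∀ q : ℝ × ℝ, (m : ℝ) < q.1 → q.1 < m + 1 → (q ∈ Y.arc g ↔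
        q.2 = (Y.height (edgeLo g) (edgeHi g) m - m * (Y.height (edgeLo g) (edgeHi g) (m + 1) -
          Y.height (edgeLo g) (edgeHi g) m)) + (Y.height (edgeLo g) (edgeHi g) (m + 1) -
          Y.height (edgeLo g) (edgeHi g) m) * q.1) := by
    intro g g1 g2 q q1 q2
    rw [Y.arc_strip (t := q.1 - m) (by ring) (by linarith) (by linarith)]
    simp only [g1, g2, true_and]
    ring_nf
  obtain ⟨e1, f1, e2, f2, hlt⟩ := h
  refine properlyCrossAt_of_affine ?_ (line e e1 e2) (line f f1 f2) (by linarith) (by linarith)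
    hpe hpf
  intro heq
  generalize Y.height (edgeLo e) (edgeHi e) m = a at *
  generalize Y.height (edgeLo e) (edgeHi e) (m + 1) = a' at *
  generalize Y.height (edgeLo f) (edgeHi f) m = b at *
  generalize Y.height (edgeLo f) (edgeHi f) (m + 1) = b' at *
  have : a' - b' = a - b := by linarith
  rw [this] at hlt
  nlinarith [mul_self_nonneg (a - b)]

theorem finite_inter_arc {e f : (⊤ : SimpleGraph (Fin n)).edgeSet} (hef : e ≠ f) :
    (Y.arc e ∩ Y.arc f).Finite := by
  have hstrip : ∀ m : ℕ, {p | p ∈ Y.arc e ∩ Y.arc f ∧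
      ∃ t : ℝ, p.1 = m + t ∧ 0 < t ∧ t < 1}.Finite := by
    intro m
    refine Set.Subsingleton.finite ?_
    rintro p ⟨hp, s, hs, hs0, hs1⟩ q ⟨hq, t, ht, ht0, ht1⟩
    exact Y.eq_of_crossAfter (Y.crossAfter_of_strip hef hs hs0 hs1 hp.1 hp.2) hs hs0 hs1 ht ht0 ht1
      hp.1 hp.2 hq.1 hq.2
  refine ((Set.finite_range Y.point).union
    ((Set.finite_Iio n).biUnion fun m _ => hstrip m)).subset ?_
  rintro p ⟨hpe, hpf⟩
  rcases Y.inter_arc hef hpe hpf with ⟨v, -, -, rfl⟩ | ⟨m, t, hx, h0, h1, h⟩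
  · exact Or.inl ⟨v, rfl⟩
  · refine Or.inr (Set.mem_biUnion (x := m) (h.2.2.1.trans (edgeHi_lt e)) ⟨⟨hpe, hpf⟩, t, hx, h0, h1⟩)

/-- The drawing by polygonal paths. -/
noncomputable def drawing : Drawing (⊤ : SimpleGraph (Fin n)) where
  point := Y.point
  arc := Y.arc
  point_injective u v h := by
    have : ((u : ℕ) : ℝ) = (v : ℕ) := congrArg Prod.fst h
    exact Fin.val_injective (Nat.cast_injective this)
  isSimpleArc u v h := by
    have huv : u ≠ v := h
    have hne : ((u : ℕ) : ℝ) ≠ (v : ℕ) := fun h => huv (Fin.val_injective (Nat.cast_injective h))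
    have hval : ∀ w : Fin n, w ∈ s(u, v) → Y.point w = (((w : ℕ) : ℝ),
        Y.curve (edgeLo ⟨s(u, v), h⟩) (edgeHi ⟨s(u, v), h⟩) (w : ℕ)) := by
      intro w hw
      refine Prod.ext rfl ?_
      change Y.vertex w = _
      rw [curve, polyline_natCast _ w.2]
      have h1 := edgeLo_lt_edgeHi ⟨s(u, v), h⟩
      have h2 := edgeHi_lt ⟨s(u, v), h⟩
      rcases (mem_edge_iff ⟨s(u, v), h⟩ w).1 hw with hw | hw
      · rw [hw, Y.left _ _ h1 h2]
      · rw [hw, Y.right _ _ h1 h2]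
    rw [hval u (by simp), hval v (by simp)]
    have e1 : edgeLo ⟨s(u, v), h⟩ = min (u : ℕ) v := Fin.coe_min u v
    have e2 : edgeHi ⟨s(u, v), h⟩ = max (u : ℕ) v := Fin.coe_max u v
    have harc : Y.arc ⟨s(u, v), h⟩ = {p | min ((u : ℕ) : ℝ) (v : ℕ) ≤ p.1 ∧
        p.1 ≤ max ((u : ℕ) : ℝ) (v : ℕ) ∧
        p.2 = Y.curve (edgeLo ⟨s(u, v), h⟩) (edgeHi ⟨s(u, v), h⟩) p.1} := by
      rw [← Nat.cast_min, ← Nat.cast_max, ← e1, ← e2]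
      rfl
    rw [harc]
    exact isSimpleArc_graph (continuous_polyline _ n) hne
  mem_of_point_mem_arc e w := by
    rintro ⟨h1, h2, h3⟩
    change ((w : ℕ) : ℝ) ≤ _ at h2
    change _ ≤ ((w : ℕ) : ℝ) at h1
    change Y.vertex w = Y.curve _ _ (w : ℕ) at h3
    rw [Nat.cast_le] at h1 h2
    rw [curve, polyline_natCast _ w.2] at h3
    rw [mem_edge_iff]
    by_contra hc
    exact Y.avoid _ _ _ (show edgeLo e < w by omega) (show (w : ℕ) < edgeHi e by omega)
      (edgeHi_lt e) h3.symm
  finite_inter _ _ hef := Y.finite_inter_arc hef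
  not_touch e f hef p hp he hf := by
    rcases Y.inter_arc hef hp.1 hp.2 with ⟨v, hv, -, rfl⟩ | ⟨m, t, hx, h0, h1, h⟩
    · exact absurd rfl (he v hv)
    · exact Y.properlyCrossAt_of_crossAfter h hx h0 h1 hp.1 hp.2
  not_three e f g hef hfg heg p he hf hg := by
    rcases Y.inter_arc hef he hf with ⟨v, hv, -, rfl⟩ | ⟨m, t, hx, h0, h1, -⟩
    · exact ⟨v, Or.inl hv, rfl⟩
    · obtain ⟨e1, e2, e3⟩ := (Y.arc_strip hx h0 h1).1 he
      obtain ⟨f1, f2, f3⟩ := (Y.arc_strip hx h0 h1).1 hf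
      obtain ⟨g1, g2, g3⟩ := (Y.arc_strip hx h0 h1).1 hg
      exact (Y.general _ _ _ _ _ _ m (edgeHi_lt e) (edgeHi_lt f) (edgeHi_lt g) (edge_ne hef)
        (edge_ne hfg) (edge_ne heg) e1 f1 g1 e2 f2 g2 t h0 h1 (e3.symm.trans f3)
        (f3.symm.trans g3)).elim

theorem isXMonotone_drawing : Y.drawing.IsXMonotone := by
  refine ⟨fun e x => ?_, fun u v h => ?_⟩
  · rintro p ⟨⟨-, -, hp⟩, rfl⟩ q ⟨⟨-, -, hq⟩, hx⟩
    refine Prod.ext hx.symm ?_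
    rw [hp, hq, hx]
  · have : ((u : ℕ) : ℝ) = (v : ℕ) := h
    exact Fin.val_injective (Nat.cast_injective this)

/-- The place of a crossing of the drawing. -/
theorem crossAfter_of_mem_crossings {e f : (⊤ : SimpleGraph (Fin n)).edgeSet} (hef : e ≠ f)
    {p : ℝ × ℝ} (hp : p ∈ Y.drawing.crossings e f) :
    p ∈ Y.arc e ∧ p ∈ Y.arc f ∧
      ∃ (m : ℕ) (t : ℝ), p.1 = m + t ∧ 0 < t ∧ t < 1 ∧ Y.CrossAfter e f m := by
  refine ⟨hp.1.1, hp.2.1.1, ?_⟩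
  rcases Y.inter_arc hef hp.1.1 hp.2.1.1 with ⟨v, hv, -, rfl⟩ | h
  · exact absurd rfl (hp.1.2 v hv)
  · exact h

theorem isSemisimple_drawing (h : ∀ e f : (⊤ : SimpleGraph (Fin n)).edgeSet, e ≠ f →
    (edgeLo e = edgeLo f ∨ edgeHi e = edgeHi f) → ∀ m, ¬ Y.CrossAfter e f m) :
    Y.drawing.IsSemisimple := by
  rintro e f hef ⟨v, hve, hvf⟩
  refine Set.eq_empty_of_forall_notMem fun p hp => ?_
  obtain ⟨-, -, m, t, -, -, -, hm⟩ := Y.crossAfter_of_mem_crossings hef hp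
  refine h e f hef ?_ m hm
  rw [mem_edge_iff] at hve hvf
  -- A vertex that ends one edge and starts the other leaves no strip in common.
  obtain ⟨h1, h2, h3, h4, -⟩ := hm
  omega

theorem isSimple_drawing (hs : Y.drawing.IsSemisimple)
    (h : ∀ e f : (⊤ : SimpleGraph (Fin n)).edgeSet, e ≠ f → edgeLo e ≠ edgeLo f →
      edgeHi e ≠ edgeHi f → ∀ m m', m < m' → Y.CrossAfter e f m → Y.CrossAfter e f m' → False) :
    Y.drawing.IsSimple := by
  refine ⟨hs, fun e f hef p hp q hq => ?_⟩
  by_cases hadj : ∃ v, v ∈ e.1 ∧ v ∈ f.1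
  · rw [hs e f hef hadj] at hp
    exact hp.elim
  have hlo : edgeLo e ≠ edgeLo f := fun h => hadj ⟨e.1.inf, (mem_edge_iff _ _).2 (Or.inl rfl),
    (mem_edge_iff _ _).2 (Or.inl h)⟩
  have hhi : edgeHi e ≠ edgeHi f := fun h => hadj ⟨e.1.sup, (mem_edge_iff _ _).2 (Or.inr rfl),
    (mem_edge_iff _ _).2 (Or.inr h)⟩
  obtain ⟨hpe, hpf, m, s, hm, hs0, hs1, hc⟩ := Y.crossAfter_of_mem_crossings hef hp
  obtain ⟨hqe, hqf, m', t, hm', ht0, ht1, hc'⟩ := Y.crossAfter_of_mem_crossings hef hq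
  rcases lt_trichotomy m m' with hlt | rfl | hlt
  · exact (h e f hef hlo hhi m m' hlt hc hc').elim
  · exact Y.eq_of_crossAfter hc hm hs0 hs1 hm' ht0 ht1 hpe hpf hqe hqf
  · exact (h e f hef hlo hhi m' m hlt hc' hc).elim

theorem induces_drawing {σ : Signature n}
    (h : ∀ i j k : Fin n, ∀ (hij : i < j) (hjk : j < k),
      (Y.height i k j < Y.vertex j → σ i j k hij hjk = -1) ∧
      (Y.vertex j < Y.height i k j → σ i j k hij hjk = 1)) : Induces Y.drawing σ := by
  refine ⟨fun i j hij => ?_, fun i j k hij hjk => ?_⟩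
  · change ((i : ℕ) : ℝ) < (j : ℕ)
    exact Nat.cast_lt.2 hij
  have e1 : edgeLo ⟨s(i, k), (hij.trans hjk).ne⟩ = i := by
    simp [edgeLo, (hij.trans hjk).le]
  have e2 : edgeHi ⟨s(i, k), (hij.trans hjk).ne⟩ = k := by
    simp [edgeHi, (hij.trans hjk).le]
  have hab : LiesAbove (Y.drawing.point j) (Y.drawing.arc ⟨s(i, k), (hij.trans hjk).ne⟩) ↔
      Y.height i k j < Y.vertex j := by
    constructor
    · rintro ⟨q, ⟨-, -, h3⟩, hq, hlt⟩
      rw [e1, e2, hq] at h3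
      change q.2 = Y.curve i k ((j : ℕ) : ℝ) at h3
      rw [curve, polyline_natCast _ j.2] at h3
      rw [h3] at hlt
      exact hlt
    · intro hlt
      refine ⟨(((j : ℕ) : ℝ), Y.height i k j), ⟨?_, ?_, ?_⟩, rfl, hlt⟩
      · rw [e1]; exact Nat.cast_le.2 hij.le
      · rw [e2]; exact Nat.cast_le.2 hjk.le
      · rw [e1, e2, curve, polyline_natCast _ j.2]
  rw [hab]
  refine ⟨(h i j k hij hjk).1, fun hn => (h i j k hij hjk).2 ?_⟩
  exact lt_of_le_of_ne (not_lt.1 hn) (Y.avoid _ _ _ hij hjk k.2).symm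

end EdgeHeights

/-! ### Necessity, by the intermediate value theorem -/

open Set in
/-- An `x`-monotone arc contains the graph of a continuous function. -/
theorem IsSimpleArc.exists_graph {p q : ℝ × ℝ} {γ : Set (ℝ × ℝ)} (h : IsSimpleArc p q γ)
    (hγ : ∀ x : ℝ, {r | r ∈ γ ∧ r.1 = x}.Subsingleton) :
    ∃ g : ℝ → ℝ, ContinuousOn g (Icc p.1 q.1) ∧ ∀ x ∈ Icc p.1 q.1, (x, g x) ∈ γ := by
  obtain ⟨c, hc, rfl⟩ := h
  set u : unitInterval → ℝ := fun t => (c t).1 with hu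
  have hcont : Continuous u := by fun_prop
  have hinj : Function.Injective u := fun s t hst =>
    hc (hγ (u t) ⟨⟨s, rfl⟩, hst⟩ ⟨⟨t, rfl⟩, rfl⟩)
  -- The first coordinate is injective along the arc, hence an embedding by compactness; its inverse
  -- parametrizes the arc by `x`.
  have hemb := hcont.isClosedEmbedding hinj
  have hsub : Icc p.1 q.1 ⊆ range u := by
    have := intermediate_value_univ (0 : unitInterval) 1 hcont
    simpa [hu] using this
  have hinv : ∀ x ∈ range u, u (Function.invFun u x) = x := fun x hx => Function.invFun_eq hx
  refine ⟨fun x => (c (Function.invFun u x)).2, ?_, fun x hx => ⟨Function.invFun u x, ?_⟩⟩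
  · refine ContinuousOn.mono ?_ hsub
    rw [continuousOn_iff_continuous_domRestrict]
    have heq : (range u).domRestrict (fun x => (c (Function.invFun u x)).2) =
        fun x => (c (hemb.isEmbedding.toHomeomorph.symm x)).2 := by
      funext x
      have : hemb.isEmbedding.toHomeomorph.symm x = Function.invFun u x := by
        rw [Homeomorph.symm_apply_eq]
        exact Subtype.ext (hinv x x.2).symm
      rw [this]
      rfl
    rw [heq]
    fun_prop
  · exact Prod.ext (hinv x (hsub hx)) rfl

theorem IsSimpleArc.left_mem {p q : ℝ × ℝ} {γ : Set (ℝ × ℝ)} (h : IsSimpleArc p q γ) : p ∈ γ := by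
  obtain ⟨c, -, rfl⟩ := h
  exact ⟨0, c.source⟩

theorem IsSimpleArc.right_mem {p q : ℝ × ℝ} {γ : Set (ℝ × ℝ)} (h : IsSimpleArc p q γ) :
    q ∈ γ := by
  obtain ⟨c, -, rfl⟩ := h
  exact ⟨1, c.target⟩

section Forward

variable {n : ℕ} {D : Drawing (⊤ : SimpleGraph (Fin n))}

/-- The edge between two vertices. -/
abbrev edgeOf {i k : Fin n} (h : i < k) : (⊤ : SimpleGraph (Fin n)).edgeSet := ⟨s(i, k), h.ne⟩

theorem edgeOf_ne {i k i' k' : Fin n} (h : i < k) (h' : i' < k') (hne : i ≠ i' ∨ k ≠ k') :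
    edgeOf h ≠ edgeOf h' := by
  intro heq
  have := congrArg Subtype.val heq
  rw [Sym2.eq_iff] at this
  omega

/-- The functions `g i k` describe the edges of the drawing `D`. -/
def AreGraphs (D : Drawing (⊤ : SimpleGraph (Fin n))) (g : Fin n → Fin n → ℝ → ℝ) : Prop :=
  ∀ (i k : Fin n) (h : i < k),
    ContinuousOn (g i k) (Set.Icc (D.point i).1 (D.point k).1) ∧
    ∀ x ∈ Set.Icc (D.point i).1 (D.point k).1, (x, g i k x) ∈ D.arc (edgeOf h)

theorem Drawing.IsXMonotone.exists_areGraphs (hD : D.IsXMonotone) : ∃ g, AreGraphs D g := by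
  have : ∀ i k : Fin n, ∃ g : ℝ → ℝ, ∀ h : i < k,
      ContinuousOn g (Set.Icc (D.point i).1 (D.point k).1) ∧
      ∀ x ∈ Set.Icc (D.point i).1 (D.point k).1, (x, g x) ∈ D.arc (edgeOf h) := by
    intro i k
    by_cases h : i < k
    · obtain ⟨g, hg, hg'⟩ := (D.isSimpleArc i k h.ne).exists_graph (hD.1 _)
      exact ⟨g, fun _ => ⟨hg, hg'⟩⟩
    · exact ⟨0, fun h' => absurd h' h⟩
  choose g hg using this
  exact ⟨g, hg⟩

variable {g : Fin n → Fin n → ℝ → ℝ} {σ : Signature n}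

theorem AreGraphs.eq_of_mem (hg : AreGraphs D g) (hD : D.IsXMonotone) {i k : Fin n} (h : i < k)
    {q : ℝ × ℝ} (hq : q ∈ D.arc (edgeOf h)) (h1 : (D.point i).1 ≤ q.1)
    (h2 : q.1 ≤ (D.point k).1) : q.2 = g i k q.1 :=
  congrArg Prod.snd (hD.1 _ q.1 ⟨hq, rfl⟩ ⟨(hg i k h).2 q.1 ⟨h1, h2⟩, rfl⟩)

theorem AreGraphs.left (hg : AreGraphs D g) (hD : D.IsXMonotone)
    (hmono : StrictMono fun i => (D.point i).1) {i k : Fin n} (h : i < k) :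
    g i k (D.point i).1 = (D.point i).2 :=
  (hg.eq_of_mem hD h (D.isSimpleArc i k h.ne).left_mem le_rfl (hmono h).le).symm

theorem AreGraphs.right (hg : AreGraphs D g) (hD : D.IsXMonotone)
    (hmono : StrictMono fun i => (D.point i).1) {i k : Fin n} (h : i < k) :
    g i k (D.point k).1 = (D.point k).2 :=
  (hg.eq_of_mem hD h (D.isSimpleArc i k h.ne).right_mem (hmono h).le le_rfl).symm

theorem AreGraphs.sign_mul_pos (hg : AreGraphs D g) (hD : D.IsXMonotone) (hσ : Induces D σ)
    {i j k : Fin n} (hij : i < j) (hjk : j < k) :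
    0 < ((σ i j k hij hjk : ℤ) : ℝ) * (g i k (D.point j).1 - (D.point j).2) := by
  have hx : (D.point j).1 ∈ Set.Icc (D.point i).1 (D.point k).1 :=
    ⟨(hσ.1 hij).le, (hσ.1 hjk).le⟩
  have hmem := (hg i k (hij.trans hjk)).2 _ hx
  have hne : g i k (D.point j).1 ≠ (D.point j).2 := by
    intro h
    rw [h] at hmem
    have := D.mem_of_point_mem_arc _ j hmem
    rw [Sym2.mem_iff] at this
    rcases this with h | h
    · exact hij.ne' h
    · exact hjk.ne h
  obtain ⟨h1, h2⟩ := hσ.2 i j k hij hjk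
  by_cases hab : LiesAbove (D.point j) (D.arc ⟨s(i, k), (hij.trans hjk).ne⟩)
  · rw [h1 hab]
    obtain ⟨q, hq, hq1, hq2⟩ := hab
    have := hg.eq_of_mem hD (hij.trans hjk) hq (hq1 ▸ hx.1) (hq1 ▸ hx.2)
    rw [hq1] at this
    rw [this] at hq2
    push_cast
    linarith
  · rw [h2 hab]
    have : ¬ g i k (D.point j).1 < (D.point j).2 := fun h => hab ⟨_, hmem, rfl, h⟩
    have := lt_of_le_of_ne (not_lt.1 this) hne.symm
    push_cast
    linarith

/-- Edges that change their order cross. -/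
theorem AreGraphs.exists_crossing (hg : AreGraphs D g) {i k i' k' : Fin n} (h : i < k)
    (h' : i' < k') (hne : edgeOf h ≠ edgeOf h') {x₁ x₂ s : ℝ} (hx : x₁ < x₂)
    (h1 : (D.point i).1 ≤ x₁) (h2 : (D.point i').1 ≤ x₁) (h3 : x₂ ≤ (D.point k).1)
    (h4 : x₂ ≤ (D.point k').1) (hs₁ : 0 < s * (g i k x₁ - g i' k' x₁))
    (hs₂ : s * (g i k x₂ - g i' k' x₂) < 0) :
    ∃ p ∈ D.crossings (edgeOf h) (edgeOf h'), x₁ < p.1 ∧ p.1 < x₂ := by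
  have hcont : ContinuousOn (fun x => s * (g i k x - g i' k' x)) (Set.Icc x₁ x₂) :=
    continuousOn_const.mul (((hg i k h).1.mono (Set.Icc_subset_Icc h1 h3)).sub
      ((hg i' k' h').1.mono (Set.Icc_subset_Icc h2 h4)))
  obtain ⟨x, ⟨hx1, hx2⟩, hx0⟩ := intermediate_value_Ioo' hx.le hcont ⟨hs₂, hs₁⟩
  have hs0 : s ≠ 0 := by rintro rfl; simp at hs₁
  have hx0 : g i k x = g i' k' x :=
    sub_eq_zero.1 ((mul_eq_zero.1 hx0).resolve_left hs0)
  have hm : (x, g i k x) ∈ D.arc (edgeOf h) :=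
    (hg i k h).2 x ⟨h1.trans hx1.le, hx2.le.trans h3⟩
  have hm' : (x, g i k x) ∈ D.arc (edgeOf h') := by
    rw [hx0]
    exact (hg i' k' h').2 x ⟨h2.trans hx1.le, hx2.le.trans h4⟩
  have hint : ∀ v ∈ (edgeOf h).1, (x, g i k x) ≠ D.point v := by
    intro v hv heq
    have hxv : x = (D.point v).1 := congrArg Prod.fst heq
    rw [Sym2.mem_iff] at hv
    rcases hv with rfl | rfl <;> linarith
  have hint' : ∀ v ∈ (edgeOf h').1, (x, g i k x) ≠ D.point v := by
    intro v hv heq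
    have hxv : x = (D.point v).1 := congrArg Prod.fst heq
    rw [Sym2.mem_iff] at hv
    rcases hv with rfl | rfl <;> linarith
  exact ⟨_, ⟨⟨hm, hint⟩, ⟨hm', hint'⟩, D.not_touch _ _ hne _ ⟨hm, hm'⟩ hint hint'⟩, hx1, hx2⟩

/-- The two conditions exclude cyclic comparisons of three edges in the right star of the first
vertex and in the left star of the last one. -/
theorem mem_allowedForms_iff (a b c d : ℤˣ) :
    (a, b, c, d) ∈ allowedForms ↔ (a = c → b = c) ∧ (b = d → c = b) := by
  have h1 : (1 : ℤˣ) ≠ -1 := by decide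
  simp only [allowedForms, Set.mem_insert_iff, Set.mem_singleton_iff, Prod.mk.injEq]
  rcases Int.units_eq_one_or a with rfl | rfl <;> rcases Int.units_eq_one_or b with rfl | rfl <;>
    rcases Int.units_eq_one_or c with rfl | rfl <;> rcases Int.units_eq_one_or d with rfl | rfl <;>
    simp [h1, h1.symm]

theorem units_int_eq_neg {a b : ℤˣ} (h : a ≠ b) : a = -b := by
  rcases Int.units_eq_one_or a with rfl | rfl <;> rcases Int.units_eq_one_or b with rfl | rfl <;>
    simp_all

/-- A cycle in a right star makes `ac` and `ad` cross between `b` and `c`; a cycle in a left star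
does the same to `ad` and `bd`. -/
theorem allFormsAllowed_of_isSemisimple (hD : D.IsXMonotone) (hs : D.IsSemisimple)
    (hσ : Induces D σ) : σ.AllFormsAllowed := by
  intro a b c d hab hbc hcd
  obtain ⟨g, hg⟩ := hD.exists_areGraphs
  have hm := hσ.1
  rw [Signature.form, mem_allowedForms_iff]
  have s1 := hg.sign_mul_pos hD hσ hab hbc
  have s2 := hg.sign_mul_pos hD hσ hab (hbc.trans hcd)
  have s3 := hg.sign_mul_pos hD hσ (hab.trans hbc) hcd
  have s4 := hg.sign_mul_pos hD hσ hbc hcd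
  constructor
  · intro h
    by_contra hne
    rw [units_int_eq_neg hne] at s2
    rw [h] at s1
    push_cast at s2
    have hedge : edgeOf (hab.trans (hbc.trans hcd)) ≠ edgeOf (hab.trans hbc) :=
      edgeOf_ne _ _ (Or.inr hcd.ne')
    obtain ⟨p, hp, -⟩ := hg.exists_crossing (hab.trans hbc) (hab.trans (hbc.trans hcd))
      hedge.symm (x₁ := (D.point b).1) (x₂ := (D.point c).1)
      (s := ((σ a c d (hab.trans hbc) hcd : ℤ) : ℝ)) (hm hbc)
      (hm hab).le (hm hab).le le_rfl (hm hcd).le (by linarith) (by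
        rw [hg.right hD hm (hab.trans hbc)]
        linarith)
    rw [hs _ _ hedge.symm ⟨a, by simp, by simp⟩] at hp
    exact hp
  · intro h
    by_contra hne
    rw [units_int_eq_neg hne] at s3
    rw [← h] at s4
    push_cast at s3
    have hedge : edgeOf (hab.trans (hbc.trans hcd)) ≠ edgeOf (hbc.trans hcd) :=
      edgeOf_ne _ _ (Or.inl hab.ne)
    obtain ⟨p, hp, -⟩ := hg.exists_crossing (hab.trans (hbc.trans hcd)) (hbc.trans hcd)
      hedge (x₁ := (D.point b).1) (x₂ := (D.point c).1)
      (s := ((σ a b d hab (hbc.trans hcd) : ℤ) : ℝ)) (hm hbc)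
      (hm hab).le le_rfl (hm hcd).le (hm hcd).le (by
        rw [hg.left hD hm (hbc.trans hcd)]
        linarith) (by linarith)
    rw [hs _ _ hedge ⟨d, by simp, by simp⟩] at hp
    exact hp

/-- Over `b` and `d` the edge `ae` is on one side of `bd`, over `c` on the other, giving a crossing
on each side of `c`. -/
theorem not_hasForbidden5Tuple_of_isSimple (hD : D.IsXMonotone) (hs : D.IsSimple)
    (hσ : Induces D σ) : ¬ σ.HasForbidden5Tuple := by
  rintro ⟨a, b, c, d, e, hab, hbc, hcd, hde, h1, h2, h3⟩
  obtain ⟨g, hg⟩ := hD.exists_areGraphs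
  have hm := hσ.1
  have s1 := hg.sign_mul_pos hD hσ hab (hbc.trans (hcd.trans hde))
  have s2 := hg.sign_mul_pos hD hσ (hab.trans (hbc.trans hcd)) hde
  have s3 := hg.sign_mul_pos hD hσ hbc hcd
  have s4 := hg.sign_mul_pos hD hσ (hab.trans hbc) (hcd.trans hde)
  rw [h1, h2, h3] at s1
  rw [h2, h3] at s2
  rw [h3] at s3
  push_cast at s1 s2 s3
  have hae : a < e := hab.trans (hbc.trans (hcd.trans hde))
  have hbd : b < d := hbc.trans hcd
  have hedge : edgeOf hae ≠ edgeOf hbd := edgeOf_ne _ _ (Or.inl hab.ne)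
  obtain ⟨p, hp, hp1, hp2⟩ := hg.exists_crossing hae hbd hedge (x₁ := (D.point b).1)
    (x₂ := (D.point c).1) (s := -((σ a c e (hab.trans hbc) (hcd.trans hde) : ℤ) : ℝ))
    (hm hbc) (hm hab).le le_rfl (hm (hcd.trans hde)).le (hm hcd).le
    (by rw [hg.left hD hm hbd]; linarith) (by linarith)
  obtain ⟨q, hq, hq1, hq2⟩ := hg.exists_crossing hae hbd hedge (x₁ := (D.point c).1)
    (x₂ := (D.point d).1) (s := ((σ a c e (hab.trans hbc) (hcd.trans hde) : ℤ) : ℝ))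
    (hm hcd) (hm (hab.trans hbc)).le (hm hbc).le (hm hde).le le_rfl
    (by linarith) (by rw [hg.right hD hm hbd]; linarith)
  have := hs.2 _ _ hedge hp hq
  rw [this] at hp2
  linarith

end Forward

/-! ### Signatures as star signs on natural numbers -/

namespace Signature

variable {n : ℕ} (σ : Signature n)

/-- The sign of a triple of natural numbers, with the value `1` outside the range of `σ`. -/
def natSign (i j k : ℕ) : ℤ :=
  if h : i < j ∧ j < k ∧ k < n then
    (σ ⟨i, h.1.trans (h.2.1.trans h.2.2)⟩ ⟨j, h.2.1.trans h.2.2⟩ ⟨k, h.2.2⟩ h.1 h.2.1 : ℤˣ)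
  else 1

theorem natSign_val {i j k : Fin n} (hij : i < j) (hjk : j < k) :
    σ.natSign i j k = (σ i j k hij hjk : ℤˣ) :=
  dif_pos ⟨hij, hjk, k.2⟩

theorem natSign_of_le {i j k : ℕ} (h : n ≤ k) : σ.natSign i j k = 1 :=
  dif_neg fun h' => absurd h'.2.2 (not_lt.2 h)

variable {σ}

/-- The linearly ordered stars of a signature in which all forms are allowed. -/
def AllFormsAllowed.starSigns (h : σ.AllFormsAllowed) : StarSigns where
  sign := σ.natSign
  sign_eq i j k := by
    unfold natSign
    split_ifs with h
    · exact Int.isUnit_iff.1 (Units.isUnit _)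
    · exact Or.inl rfl
  right_trans i j k l hij hjk hkl heq := by
    by_cases hl : l < n
    · lift l to Fin n using hl
      lift k to Fin n using hkl.trans l.2
      lift j to Fin n using hjk.trans k.2
      lift i to Fin n using hij.trans j.2
      have hf := ((mem_allowedForms_iff _ _ _ _).1 (h i j k l hij hjk hkl)).1
      rw [σ.natSign_val (i := i) (j := j) (k := k) hij hjk,
        σ.natSign_val (i := i) (j := k) (k := l) (hij.trans hjk) hkl, Units.val_inj] at heq
      rw [σ.natSign_val (i := i) (j := j) (k := l) hij (hjk.trans hkl),
        σ.natSign_val (i := i) (j := k) (k := l) (hij.trans hjk) hkl, Units.val_inj]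
      exact hf heq
    -- Both triples end at `l`, so both signs are the default 1 and the padding preserves
    -- transitivity.
    · rw [σ.natSign_of_le (not_lt.1 hl), σ.natSign_of_le (not_lt.1 hl)]
  left_trans i j k l hij hjk hkl heq := by
    by_cases hl : l < n
    · lift l to Fin n using hl
      lift k to Fin n using hkl.trans l.2
      lift j to Fin n using hjk.trans k.2
      lift i to Fin n using hij.trans j.2
      have hf := ((mem_allowedForms_iff _ _ _ _).1 (h i j k l hij hjk hkl)).2
      rw [σ.natSign_val (i := i) (j := j) (k := l) hij (hjk.trans hkl),
        σ.natSign_val (i := j) (j := k) (k := l) hjk hkl, Units.val_inj] at heq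
      rw [σ.natSign_val (i := i) (j := j) (k := l) hij (hjk.trans hkl),
        σ.natSign_val (i := i) (j := k) (k := l) (hij.trans hjk) hkl, Units.val_inj]
      exact hf heq
    · rw [σ.natSign_of_le (not_lt.1 hl), σ.natSign_of_le (not_lt.1 hl)]

theorem AllFormsAllowed.noDoubleCrossing (h : σ.AllFormsAllowed) (h5 : ¬ σ.HasForbidden5Tuple) :
    h.starSigns.NoDoubleCrossing := by
  rintro a b c d e hab hbc hcd hde ⟨h1, h2, h3⟩
  change σ.natSign a b e = σ.natSign a d e at h1
  change σ.natSign a d e = σ.natSign b c d at h2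
  change σ.natSign b c d = -σ.natSign a c e at h3
  by_cases he : e < n
  · lift e to Fin n using he
    lift d to Fin n using hde.trans e.2
    lift c to Fin n using hcd.trans d.2
    lift b to Fin n using hbc.trans c.2
    lift a to Fin n using hab.trans b.2
    have hab : a < b := hab
    have hbc : b < c := hbc
    have hcd : c < d := hcd
    have hde : d < e := hde
    refine h5 ⟨a, b, c, d, e, hab, hbc, hcd, hde, ?_, ?_, ?_⟩
    · rwa [σ.natSign_val hab (hbc.trans (hcd.trans hde)),
        σ.natSign_val (hab.trans (hbc.trans hcd)) hde, Units.val_inj] at h1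
    · rwa [σ.natSign_val (hab.trans (hbc.trans hcd)) hde, σ.natSign_val hbc hcd,
        Units.val_inj] at h2
    · rwa [σ.natSign_val hbc hcd, σ.natSign_val (hab.trans hbc) (hcd.trans hde),
        ← Units.val_neg, Units.val_inj] at h3
  -- Here the default value would give `1 = -1`.
  · rw [σ.natSign_of_le (not_lt.1 he)] at h2 h3
    omega

end Signature

/-! ### General position by exponential heights -/

/-- Three segments between two vertical lines, whose ends are bounded integers on one line and
integer powers of a large number on the other one, have no common point. -/
theorem not_concurrent_of_lt {C w v : ℝ} {M p₁ p₂ p₃ q₁ q₂ q₃ : ℤ} (hC : 2 * M ≤ C) (hC1 : 1 ≤ C)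
    (hw : 0 < w) (hv : 0 < v) (h12 : q₁ < q₂) (h23 : q₂ < q₃) (hp₁ : |p₁| < M) (hp₃ : |p₃| < M)
    (he : w * p₁ + v * C ^ q₁ = w * p₂ + v * C ^ q₂)
    (hf : w * p₂ + v * C ^ q₂ = w * p₃ + v * C ^ q₃) : False := by
  have hC0 : 0 < C := by linarith
  have hq1 : 0 < C ^ q₁ := zpow_pos hC0 _
  have hC1' : 1 < C := by
    refine lt_of_le_of_ne hC1 ?_
    rintro rfl
    have : (0 : ℝ) < M := by exact_mod_cast (abs_nonneg _).trans_lt hp₁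
    have h1 : (1 : ℝ) ≤ M := by exact_mod_cast (abs_nonneg _).trans_lt hp₁
    linarith
  have hq12 : C ^ q₁ < C ^ q₂ := zpow_lt_zpow_right₀ hC1' h12
  have hq23 : C * C ^ q₂ ≤ C ^ q₃ := by
    rw [← zpow_one_add₀ hC0.ne']
    exact zpow_le_zpow_right₀ hC1 (by omega)
  have hp12 : (1 : ℝ) ≤ p₁ - p₂ := by
    have h : (p₂ : ℝ) < p₁ := by
      have : 0 < w * (p₁ - p₂) := by nlinarith
      have := (pos_iff_pos_of_mul_pos this).1 hw
      linarith
    have : p₂ + 1 ≤ p₁ := by exact_mod_cast h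
    have : ((p₂ + 1 : ℤ) : ℝ) ≤ p₁ := by exact_mod_cast this
    push_cast at this
    linarith
  have hp13 : (p₁ : ℝ) - p₃ ≤ C := by
    rw [abs_lt] at hp₁ hp₃
    have : ((p₁ - p₃ : ℤ) : ℝ) ≤ ((2 * M : ℤ) : ℝ) := by
      exact_mod_cast (by omega : p₁ - p₃ ≤ 2 * M)
    push_cast at this
    linarith
  -- Integrality gives `p₁ - p₂ ≥ 1` and boundedness `p₁ - p₃ ≤ C`. Hence `C ^ q₃ - C ^ q₁` is at
  -- most `C` times `C ^ q₂ - C ^ q₁`, which is too small for increasing powers.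
  have h1 : v * (C ^ q₃ - C ^ q₁) ≤ w * C := by
    have : v * (C ^ q₃ - C ^ q₁) = w * (p₁ - p₃) := by linarith
    rw [this]
    exact mul_le_mul_of_nonneg_left hp13 hw.le
  have h2 : w ≤ v * (C ^ q₂ - C ^ q₁) := by
    have : v * (C ^ q₂ - C ^ q₁) = w * (p₁ - p₂) := by linarith
    rw [this]
    nlinarith
  have h3 : v * (C ^ q₃ - C ^ q₁) ≤ v * (C * (C ^ q₂ - C ^ q₁)) := by nlinarith
  have h4 := le_of_mul_le_mul_left h3 hv
  nlinarith

theorem not_concurrent {C w v : ℝ} {M p₁ p₂ p₃ q₁ q₂ q₃ : ℤ} (hC : 2 * M ≤ C) (hC1 : 1 ≤ C)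
    (hw : 0 < w) (hv : 0 < v) (h12 : q₁ ≠ q₂) (h23 : q₂ ≠ q₃) (h13 : q₁ ≠ q₃)
    (hp₁ : |p₁| < M) (hp₂ : |p₂| < M) (hp₃ : |p₃| < M)
    (he : w * p₁ + v * C ^ q₁ = w * p₂ + v * C ^ q₂)
    (hf : w * p₂ + v * C ^ q₂ = w * p₃ + v * C ^ q₃) : False := by
  rcases lt_or_gt_of_ne h12 with a | a <;> rcases lt_or_gt_of_ne h23 with b | b <;>
    rcases lt_or_gt_of_ne h13 with c | c
  · exact not_concurrent_of_lt hC hC1 hw hv a b hp₁ hp₃ he hf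
  · omega
  · exact not_concurrent_of_lt hC hC1 hw hv c b hp₁ hp₂ (he.trans hf) hf.symm
  · exact not_concurrent_of_lt hC hC1 hw hv c a hp₃ hp₂ (he.trans hf).symm he
  · exact not_concurrent_of_lt hC hC1 hw hv a c hp₂ hp₃ he.symm (he.trans hf)
  · exact not_concurrent_of_lt hC hC1 hw hv b c hp₂ hp₁ hf (he.trans hf).symm
  · omega
  · exact not_concurrent_of_lt hC hC1 hw hv b a hp₃ hp₁ hf.symm he.symm

/-- The integer heights are kept over even vertices and exponentiated over odd ones. -/
noncomputable def scaleHeight (C : ℝ) (m : ℕ) (h : ℤ) : ℝ := if Even m then h else C ^ h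

theorem strictMono_scaleHeight {C : ℝ} (hC : 1 < C) (m : ℕ) : StrictMono (scaleHeight C m) := by
  intro a b hab
  unfold scaleHeight
  split_ifs
  · exact_mod_cast hab
  · exact zpow_lt_zpow_right₀ hC hab

theorem StrictMono.mul_sub_neg {φ ψ : ℤ → ℝ} (hφ : StrictMono φ) (hψ : StrictMono ψ)
    {a b a' b' : ℤ} (h : (φ a - φ b) * (ψ a' - ψ b') < 0) : (a - b) * (a' - b') < 0 := by
  rcases mul_neg_iff.1 h with ⟨h1, h2⟩ | ⟨h1, h2⟩
  · have := hφ.lt_iff_lt.1 (sub_pos.1 h1)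
    have := hψ.lt_iff_lt.1 (sub_neg.1 h2)
    exact mul_neg_of_pos_of_neg (by omega) (by omega)
  · have := hφ.lt_iff_lt.1 (sub_neg.1 h1)
    have := hψ.lt_iff_lt.1 (sub_pos.1 h2)
    exact mul_neg_of_neg_of_pos (by omega) (by omega)

/-! ### Sufficiency: the drawing of a system of star signs -/

namespace StarSigns

variable (S : StarSigns) (n : ℕ)

/-- The base of the exponential heights. -/
noncomputable def base (n : ℕ) : ℝ := 2 * 3 ^ (2 * n + 2)

theorem one_lt_base : 1 < base n := by
  have : (1 : ℝ) ≤ 3 ^ (2 * n + 2) := one_le_pow₀ (by norm_num)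
  unfold base
  linarith

/-- The heights of the edges in a drawing with the given signs. -/
noncomputable def edgeHeights : EdgeHeights n where
  height i k m := scaleHeight (base n) m (S.height n i k m)
  vertex m := scaleHeight (base n) m 0
  left i k _ _ := by rw [S.height_left]
  right i k _ _ := by rw [S.height_right]
  avoid i m k him hmk _ h := by
    have h0 := (strictMono_scaleHeight (one_lt_base n) m).injective h
    have := S.sign_mul_height_pos (n := n) him hmk
    rw [h0, mul_zero] at this
    exact lt_irrefl _ this
  distinct i k i' k' m hk hk' hne h1 h2 h3 h4 h := by
    by_contra hc
    exact S.height_ne hk hk' hne h1 h2 h3 h4 hc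
      ((strictMono_scaleHeight (one_lt_base n) m).injective h)
  general i₁ k₁ i₂ k₂ i₃ k₃ m hk₁ hk₂ hk₃ hne₁₂ hne₂₃ hne₁₃ hi₁ hi₂ hi₃ hm₁ hm₂ hm₃ t ht0 ht1
      he hf := by
    -- Edges meeting inside the strip have distinct heights on both sides: equality on one side
    -- would force equality on the other.
    have key : ∀ i k i' k', k < n → k' < n → (i ≠ i' ∨ k ≠ k') → i ≤ m → i' ≤ m → m < k →
        m < k' →
        (1 - t) * scaleHeight (base n) m (S.height n i k m) +
          t * scaleHeight (base n) (m + 1) (S.height n i k (m + 1)) =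
        (1 - t) * scaleHeight (base n) m (S.height n i' k' m) +
          t * scaleHeight (base n) (m + 1) (S.height n i' k' (m + 1)) →
        S.height n i k m ≠ S.height n i' k' m ∧
          S.height n i k (m + 1) ≠ S.height n i' k' (m + 1) := by
      intro i k i' k' hk hk' hne hi hi' hm hm' heq
      have hnot : ¬ (S.height n i k m = S.height n i' k' m ∧
          S.height n i k (m + 1) = S.height n i' k' (m + 1)) := by
        rintro ⟨e1, e2⟩
        have a1 := mt (S.height_ne hk hk' hne hi hi' hm.le hm'.le) (not_not.2 e1)
        have a2 := mt (S.height_ne (m := m + 1) hk hk' hne (by omega) (by omega) hm hm')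
          (not_not.2 e2)
        omega
      constructor
      · intro e1
        rw [e1] at heq
        exact hnot ⟨e1, (strictMono_scaleHeight (one_lt_base n) (m + 1)).injective
          (mul_left_cancel₀ ht0.ne' (add_left_cancel heq))⟩
      · intro e2
        rw [e2] at heq
        exact hnot ⟨(strictMono_scaleHeight (one_lt_base n) m).injective
          (mul_left_cancel₀ (sub_pos.2 ht1).ne' (add_right_cancel heq)), e2⟩
    obtain ⟨a1, b1⟩ := key _ _ _ _ hk₁ hk₂ hne₁₂ hi₁ hi₂ hm₁ hm₂ he
    obtain ⟨a2, b2⟩ := key _ _ _ _ hk₂ hk₃ hne₂₃ hi₂ hi₃ hm₂ hm₃ hf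
    obtain ⟨a3, b3⟩ := key _ _ _ _ hk₁ hk₃ hne₁₃ hi₁ hi₃ hm₁ hm₃ (he.trans hf)
    have hC : 2 * (((3 : ℤ) ^ (2 * n + 2) : ℤ) : ℝ) ≤ base n := by
      unfold base
      push_cast
      exact le_rfl
    have hb : ∀ i k l, l ≤ n → |S.height n i k l| < (3 : ℤ) ^ (2 * n + 2) := fun i k l hl =>
      S.abs_height_lt n i k l hl
    -- Exactly one side of the strip is odd, so integers face powers of the base.
    by_cases hm : Even m
    · have hm' : ¬ Even (m + 1) := by rwa [Nat.even_add_one, not_not]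
      simp only [scaleHeight, if_pos hm, if_neg hm'] at he hf
      exact not_concurrent hC (one_lt_base n).le (sub_pos.2 ht1) ht0 b1 b2 b3
        (hb _ _ _ (by omega)) (hb _ _ _ (by omega)) (hb _ _ _ (by omega)) he hf
    · have hm' : Even (m + 1) := by rwa [Nat.even_add_one]
      simp only [scaleHeight, if_neg hm, if_pos hm'] at he hf
      rw [add_comm, add_comm ((1 - t) * _)] at he hf
      exact not_concurrent hC (one_lt_base n).le ht0 (sub_pos.2 ht1) a1 a2 a3
        (hb _ _ _ (by omega)) (hb _ _ _ (by omega)) (hb _ _ _ (by omega)) he hf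

variable {n}

theorem height_mul_neg_of_crossAfter {e f : (⊤ : SimpleGraph (Fin n)).edgeSet} {m : ℕ}
    (h : (S.edgeHeights n).CrossAfter e f m) :
    (S.height n (edgeLo e) (edgeHi e) m - S.height n (edgeLo f) (edgeHi f) m) *
      (S.height n (edgeLo e) (edgeHi e) (m + 1) - S.height n (edgeLo f) (edgeHi f) (m + 1)) < 0 :=
  (strictMono_scaleHeight (one_lt_base n) m).mul_sub_neg
    (strictMono_scaleHeight (one_lt_base n) (m + 1)) h.2.2.2.2

theorem isSemisimple_edgeHeights : (S.edgeHeights n).drawing.IsSemisimple := by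
  refine EdgeHeights.isSemisimple_drawing _ fun e f hef hadj m hm => ?_
  have hneg := S.height_mul_neg_of_crossAfter hm
  obtain ⟨h1, h2, h3, h4, -⟩ := hm
  obtain ⟨s, hs⟩ := S.height_sub_of_adjacent (edgeHi_lt e) (edgeHi_lt f) (edge_ne hef) hadj
  have d1 := hs m h1 h2 h3.le h4.le (fun h => by simp [h] at hneg)
  have d2 := hs (m + 1) (by omega) (by omega) h3 h4 (fun h => by simp [h] at hneg)
  nlinarith [mul_pos d1 d2, sq_nonneg s]

theorem isSimple_edgeHeights (hS : S.NoDoubleCrossing) :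
    (S.edgeHeights n).drawing.IsSimple := by
  refine EdgeHeights.isSimple_drawing _ S.isSemisimple_edgeHeights
    fun e f hef hlo hhi m m' hmm hm hm' => ?_
  have hneg := S.height_mul_neg_of_crossAfter hm
  have hneg' := S.height_mul_neg_of_crossAfter hm'
  obtain ⟨h1, h2, h3, h4, -⟩ := hm
  obtain ⟨h1', h2', h3', h4', -⟩ := hm'
  -- The orders over `m'` and `m' + 1` are opposite, so one of them is `s` again, completing the
  -- pattern `s, -s, s`.
  have alt : ∀ s : ℤ, (s = 1 ∨ s = -1) →
      0 < s * (S.height n (edgeLo e) (edgeHi e) m - S.height n (edgeLo f) (edgeHi f) m) →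
      s * (S.height n (edgeLo e) (edgeHi e) (m + 1) -
        S.height n (edgeLo f) (edgeHi f) (m + 1)) < 0 → False := by
    intro s hs hp hq
    by_cases hr : 0 < s * (S.height n (edgeLo e) (edgeHi e) m' -
        S.height n (edgeLo f) (edgeHi f) m')
    · have hne : m' ≠ m + 1 := by
        rintro rfl
        exact lt_asymm hr hq
      exact hS.height_sub hs (edgeHi_lt e) (edgeHi_lt f) hlo hhi h1 h2 (Nat.lt_succ_self m)
        (by omega) h3'.le h4'.le hp hq hr
    · have hr' : 0 < s * (S.height n (edgeLo e) (edgeHi e) (m' + 1) -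
          S.height n (edgeLo f) (edgeHi f) (m' + 1)) := by
        rcases mul_neg_iff.1 hneg' with ⟨a, b⟩ | ⟨a, b⟩ <;> rcases hs with rfl | rfl <;> omega
      exact hS.height_sub hs (edgeHi_lt e) (edgeHi_lt f) hlo hhi h1 h2 (Nat.lt_succ_self m)
        (by omega) h3' h4' hp hq hr'
  rcases mul_neg_iff.1 hneg with ⟨a, b⟩ | ⟨a, b⟩
  · exact alt 1 (Or.inl rfl) (by omega) (by omega)
  · exact alt (-1) (Or.inr rfl) (by omega) (by omega)

end StarSigns

theorem Signature.AllFormsAllowed.induces {n : ℕ} {σ : Signature n} (h : σ.AllFormsAllowed) :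
    Induces (h.starSigns.edgeHeights n).drawing σ := by
  refine EdgeHeights.induces_drawing _ fun i j k hij hjk => ?_
  have hmono := strictMono_scaleHeight (StarSigns.one_lt_base n) j
  have hpos := h.starSigns.sign_mul_height_pos (n := n) (i := i) (m := j) (k := k) hij hjk
  have hsign : h.starSigns.sign i j k = (σ i j k hij hjk : ℤˣ) := σ.natSign_val hij hjk
  rw [hsign] at hpos
  refine ⟨fun hlt => ?_, fun hlt => ?_⟩
  · have hlt : h.starSigns.height n i k j < 0 := hmono.lt_iff_lt.1 hlt
    rcases Int.units_eq_one_or (σ i j k hij hjk) with h1 | h1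
    · rw [h1] at hpos
      push_cast at hpos
      omega
    · exact h1
  · have hlt : 0 < h.starSigns.height n i k j := hmono.lt_iff_lt.1 hlt
    rcases Int.units_eq_one_or (σ i j k hij hjk) with h1 | h1
    · exact h1
    · rw [h1] at hpos
      push_cast at hpos
      omega

theorem theorem3 (n : ℕ) (σ : Signature n) :
    ((∃ D : Drawing (⊤ : SimpleGraph (Fin n)),
        D.IsXMonotone ∧ D.IsSemisimple ∧ Induces D σ) ↔ σ.AllFormsAllowed) ∧
    ((∃ D : Drawing (⊤ : SimpleGraph (Fin n)),
        D.IsXMonotone ∧ D.IsSimple ∧ Induces D σ) ↔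
      (σ.AllFormsAllowed ∧ ¬ σ.HasForbidden5Tuple)) := by
  refine ⟨⟨?_, fun h => ?_⟩, ⟨?_, fun h => ?_⟩⟩
  · rintro ⟨D, hx, hs, hσ⟩
    exact allFormsAllowed_of_isSemisimple hx hs hσ
  · exact ⟨_, EdgeHeights.isXMonotone_drawing _, h.starSigns.isSemisimple_edgeHeights, h.induces⟩
  · rintro ⟨D, hx, hs, hσ⟩
    exact ⟨allFormsAllowed_of_isSemisimple hx hs.1 hσ, not_hasForbidden5Tuple_of_isSimple hx hs hσ⟩
  · exact ⟨_, EdgeHeights.isXMonotone_drawing _,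
      h.1.starSigns.isSimple_edgeHeights (h.1.noDoubleCrossing h.2), h.1.induces⟩
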